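/- Let $p$ be a prime number, and put $q=p$ if $p$ is odd and $q=4$ if $p=2$. Let $\mathbb{C}_p$ be the completion of an algebraic closure of $\mathbb{Q}_p$, with $|p|=p^{-1}$, and let $D=\{s\in\mathbb{C}_p : |s|<q\,p^{-1/(p-1)}\}$. Let $\omega$ be the Teichmüller character with values in $\mathbb{C}_p$ (the Dirichlet character modulo $q$ whose values at integers $a$ prime to $p$ are the roots of unity $\omega(a)\in\mathbb{Z}_p^\times$ with $\omega(a)\equiv a \bmod q$, of order dividing $p-1$ if $p$ is odd, and $\omega(a)=\pm1$ if $p=2$). For an integer $a$ prime to $p$ put $\langle a\rangle=\omega(a)^{-1}a$ and $\langle a\rangle^{s}=\sum_{n\ge 0}\binom{s}{n}(\langle a\rangle-1)^n$ for $s\in D$. Let $\chi$ be an even primitive Dirichlet character of conductor $f$ with values in $\mathbb{C}_p$; for $n\ge 1$ let $\chi\omega^{-n}$ denote the primitive Dirichlet character attached to the product. Let $L_p(s,\chi)$ be the $p$-adic $L$-function of $\chi$, that is, the unique function on $D$ that is given by a convergent power series in $s$ on $D$ if $\chi\ne 1$, respectively such that $(s-1)L_p(s,\chi)$ is given on $D\setminus\{1\}$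 by a power series in $s$ that converges on $D$ if $\chi=1$ (then $L_p(s,\chi)$ is considered on $D\setminus\{1\}$), and that satisfies $$L_p(1-n,\chi)=-\bigl(1-\chi\omega^{-n}(p)\,p^{n-1}\bigr)\frac{B_{n,\chi\omega^{-n}}}{n}\qquad\text{for all integers } n\ge 1,$$ where $B_{n,\psi}=m^{n-1}\sum_{a=1}^{m}\psi(a)B_n(a/m)$ is the generalized Bernoulli number of a primitive Dirichlet character $\psi$ of conductor $m$, and $B_n(x)$ is the $n$-th Bernoulli polynomial. Let $F$ be a positive common multiple of $q$ and $f$, and let $c>1$ be an integer with $(c,F)=1$. For $a\in\mathbb{Z}$ put $$\epsilon_{a,c,F}=\frac{c-1}{2}-\{-aF^{-1}\}_c ,$$ where $F^{-1}$ is the inverse of $F$ modulo $c$ and $\{x\}_c$ is the representative of $x \bmod c$ in $\{0,1,\dots,c-1\}$. Then $\epsilon_{a,c,F}\in\{-\frac{c-1}{2},-\frac{c-1}{2}+1,\dots,\frac{c-1}{2}\}$ for all $a\in\mathbb{Z}$, and for every $s\in D$ (with $s\neq 1$ if $\chi=1$) $$\Bigl|\,-\bigl(1-\chi(c)\langle c\rangle^{1-s}\bigr)L_p(s,\chi)\;-\sum_{\substack{1\le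 a\le F\\ p\,\nmid\, a}}\chi\omega^{-1}(a)\,\langle a\rangle^{-s}\,\epsilon_{a,c,F}\Bigr|\;\le\;\Bigl|\frac{F}{qp}\Bigr| .$$ If $\chi=1$, then $-\bigl(1-\chi(c)\langle c\rangle^{1-s}\bigr)L_p(s,\chi)$ has a limit in $\mathbb{C}_p$ as $s\to 1$, and the same inequality holds at $s=1$ with this limit in place of the product. -/

import Mathlib

open scoped Topology

namespace KubotaLeopoldt

noncomputable section

/-- `q = p` if `p` is odd and `q = 4` if `p = 2`. -/
def q (p : ℕ) : ℕ := if p = 2 then 4 else p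

/-- The radius `q * p ^ (-1 / (p - 1))`. -/
def radius (p : ℕ) : ℝ := (q p : ℝ) * (p : ℝ) ^ (-(1 : ℝ) / ((p : ℝ) - 1))

variable (p : ℕ) [Fact p.Prime]

/-- The inclusion of `ℤ_p` into `ℂ_p`. -/
def intEmb : ℤ_[p] →+* ℂ_[p] := (algebraMap ℚ_[p] ℂ_[p]).comp PadicInt.Coe.ringHom

/-- The multiplicative lift `𝔽_p → ℤ_p`, as a Dirichlet character modulo `p`. -/
def teichmullerLift : DirichletCharacter ℤ_[p] p :=
  { ((WittVector.equiv p).toMonoidHom.comp (WittVector.teichmuller p) : ZMod p →* ℤ_[p]) with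
    map_nonunit' := by
      intro a ha
      have h0 : a = 0 := by
        by_contra h
        exact ha (isUnit_iff_ne_zero.mpr h)
      subst h0
      simp [WittVector.teichmuller_zero] }

/-- The Teichmüller character `ω`, a Dirichlet character modulo `q` with values in `ℂ_p`: the
multiplicative lift of residues modulo `p` if `p` is odd, the nontrivial character modulo `4`
if `p = 2`. In both cases `ω a ≡ a` modulo `q`, see `norm_omega_sub_le`. -/
def omega : DirichletCharacter ℂ_[p] (q p) :=
  if h : p = 2 then
    DirichletCharacter.changeLevel (show 4 ∣ q p by simp [q, h])
      (ZMod.χ₄.ringHomComp (Int.castRingHom ℂ_[p]))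
  else
    DirichletCharacter.changeLevel (show p ∣ q p by simp [q, h])
      ((teichmullerLift p).ringHomComp (intEmb p))

/-- `⟨a⟩ = ω(a)⁻¹ a` for an integer `a` prime to `p`. -/
def angle (a : ℕ) : ℂ_[p] := (omega p (a : ZMod (q p)))⁻¹ * (a : ℂ_[p])

/-- The binomial coefficient `s (s - 1) ⋯ (s - n + 1) / n!`. -/
def binom (s : ℂ_[p]) (n : ℕ) : ℂ_[p] :=
  (∏ i ∈ Finset.range n, (s - (i : ℂ_[p]))) / (n.factorial : ℂ_[p])

/-- The power `⟨a⟩ ^ s`, given by the binomial series `∑ n, binom s n * (⟨a⟩ - 1) ^ n`, which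
converges for `‖s‖ < q p ^ (-1 / (p - 1))` and `a` prime to `p`. -/
def anglePow (a : ℕ) (s : ℂ_[p]) : ℂ_[p] := ∑' n : ℕ, binom p s n * (angle p a - 1) ^ n

variable {p}

/-- The primitive Dirichlet character attached to `χ ω⁻ⁿ`. -/
def twist {f : ℕ} (χ : DirichletCharacter ℂ_[p] f) (n : ℕ) :
    DirichletCharacter ℂ_[p] (χ.mul ((omega p)⁻¹ ^ n)).conductor :=
  χ.primitive_mul ((omega p)⁻¹ ^ n)

/-- The generalized Bernoulli number `B_{n,ψ} = m ^ (n - 1) ∑_{a=1}^m ψ(a) B_n(a / m)` of a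
Dirichlet character `ψ` modulo `m` (used for primitive `ψ`). -/
def genBernoulli {m : ℕ} (ψ : DirichletCharacter ℂ_[p] m) (n : ℕ) : ℂ_[p] :=
  (m : ℂ_[p]) ^ ((n : ℤ) - 1) * ∑ a ∈ Finset.Icc 1 m,
    ψ (a : ZMod m) * Polynomial.aeval ((a : ℂ_[p]) / (m : ℂ_[p])) (Polynomial.bernoulli n)

/-- `g` is given by one convergent power series at all points of the disc
`‖s‖ < q p ^ (-1 / (p - 1))` that satisfy `P`. -/
def IsPowerSeriesOn (P : ℂ_[p] → Prop) (g : ℂ_[p] → ℂ_[p]) : Prop :=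
  ∃ b : ℕ → ℂ_[p], ∀ s : ℂ_[p], ‖s‖ < radius p →
    ∃ t : ℂ_[p], HasSum (fun n : ℕ => b n * s ^ n) t ∧ (P s → g s = t)

/-- The characterization of the `p`-adic `L`-function of `χ`: a function on the disc
`‖s‖ < q p ^ (-1 / (p - 1))`, analytic if `χ ≠ 1` and analytic up to an at most simple pole at
`s = 1` if `χ = 1`, such that
`L(1 - n) = -(1 - χω⁻ⁿ(p) p ^ (n - 1)) B_{n,χω⁻ⁿ} / n` for all `n ≥ 1`. -/
structure IsPadicLFunction {f : ℕ} (χ : DirichletCharacter ℂ_[p] f) (L : ℂ_[p] → ℂ_[p]) :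
    Prop where
  analytic : χ ≠ 1 → IsPowerSeriesOn (fun _ => True) L
  meromorphic : χ = 1 → IsPowerSeriesOn (fun s => s ≠ 1) (fun s => (s - 1) * L s)
  interpolation : ∀ n : ℕ, 1 ≤ n →
    L (1 - (n : ℂ_[p])) =
      -(1 - twist χ n (p : ZMod _) * (p : ℂ_[p]) ^ (n - 1)) *
        (genBernoulli (twist χ n) n / (n : ℂ_[p]))

open Classical in
/-- The `p`-adic `L`-function `L_p(s, χ)`: the function with the property `IsPadicLFunction χ`.
It is unique on the disc `‖s‖ < q p ^ (-1 / (p - 1))`, except for the value at the pole `s = 1`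
if `χ = 1`. -/
def padicL {f : ℕ} (χ : DirichletCharacter ℂ_[p] f) : ℂ_[p] → ℂ_[p] :=
  if h : ∃ L : ℂ_[p] → ℂ_[p], IsPadicLFunction χ L then h.choose else 0

/-- `ε_{a,c,F} = (c - 1) / 2 - {-a F⁻¹}_c`, where `{x}_c` is the representative of `x` modulo `c`
between `0` and `c - 1`, and `F⁻¹` is the inverse modulo `c`. -/
def eps (a : ℤ) (c F : ℕ) : ℚ :=
  ((c : ℚ) - 1) / 2 - ((-(a : ZMod c) * (F : ZMod c)⁻¹).val : ℚ)

/-- The finite sum of `χω⁻¹(a) ⟨a⟩ ^ (-s) ε_{a,c,F}` over `1 ≤ a ≤ F` with `p ∤ a`. -/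
def dirichletSum {f : ℕ} (χ : DirichletCharacter ℂ_[p] f) (c F : ℕ) (s : ℂ_[p]) : ℂ_[p] :=
  ∑ a ∈ (Finset.Icc 1 F).filter (fun a => ¬ p ∣ a),
    twist χ 1 (a : ZMod _) * anglePow p a (-s) * ((eps (a : ℤ) c F : ℚ) : ℂ_[p])

/-- The regularized function `-(1 - χ(c) ⟨c⟩ ^ (1 - s)) L_p(s, χ)`. -/
def regularizedL {f : ℕ} (χ : DirichletCharacter ℂ_[p] f) (c : ℕ) (s : ℂ_[p]) : ℂ_[p] :=
  -(1 - χ (c : ZMod f) * anglePow p c (1 - s)) * padicL χ s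

/-- The Teichmüller character is congruent to the identity modulo `q`. -/
theorem norm_omega_sub_le (a : ℕ) (ha : ¬ p ∣ a) :
    ‖omega p (a : ZMod (q p)) - (a : ℂ_[p])‖ ≤ ((q p : ℝ))⁻¹ := by
  have hp : p.Prime := Fact.out
  have key : ∀ z : ℤ_[p], ‖intEmb p z‖ = ‖z‖ := by
    intro z
    change ‖algebraMap ℚ_[p] ℂ_[p] (z : ℚ_[p])‖ = ‖z‖
    rw [norm_algebraMap', PadicInt.norm_def]
  by_cases h : p = 2
  · subst h
    have hodd : a % 2 = 1 := by omega
    have hu : IsUnit (a : ZMod (q 2)) := by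
      rw [ZMod.isUnit_iff_coprime]
      exact Nat.Coprime.pow_right 2 (Nat.coprime_two_right.mpr (Nat.odd_iff.mpr hodd))
    have h1 : omega 2 (a : ZMod (q 2)) = ((ZMod.χ₄ (a : ZMod 4) : ℤ) : ℂ_[2]) := by
      rw [omega, dif_pos rfl]
      have := DirichletCharacter.changeLevel_eq_cast_of_dvd
        (ZMod.χ₄.ringHomComp (Int.castRingHom ℂ_[2])) (show 4 ∣ q 2 by simp [q]) hu.unit
      rw [IsUnit.unit_spec, ZMod.cast_natCast (show 4 ∣ q 2 by simp [q]) a] at this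
      rw [this, MulChar.ringHomComp_apply]
      rfl
    have h2 : ((ZMod.χ₄ (a : ZMod 4) : ℤ) : ℂ_[2]) - (a : ℂ_[2]) =
        intEmb 2 ((ZMod.χ₄ (a : ZMod 4) - (a : ℤ) : ℤ) : ℤ_[2]) := by
      rw [map_intCast]
      push_cast
      rfl
    have h3 : ((2 ^ 2 : ℕ) : ℤ) ∣ ZMod.χ₄ (a : ZMod 4) - (a : ℤ) := by
      rw [ZMod.χ₄_nat_eq_if_mod_four]
      split_ifs <;> omega
    rw [h1, h2, key]
    refine (PadicInt.norm_int_le_pow_iff_dvd (n := 2).mpr (by exact_mod_cast h3)).trans (le_of_eq ?_)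
    norm_num [q]
  · have hu : IsUnit (a : ZMod (q p)) := by
      have : q p = p := by simp [q, h]
      rw [ZMod.isUnit_iff_coprime, this]
      exact ((Nat.Prime.coprime_iff_not_dvd hp).mpr ha).symm
    have h1 : omega p (a : ZMod (q p)) = intEmb p (teichmullerLift p (a : ZMod p)) := by
      rw [omega, dif_neg h]
      have := DirichletCharacter.changeLevel_eq_cast_of_dvd
        ((teichmullerLift p).ringHomComp (intEmb p))
        (show p ∣ q p by simp [q, h]) hu.unit
      rw [IsUnit.unit_spec] at this
      rw [this, MulChar.ringHomComp_apply]
      congr 2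
      exact ZMod.cast_natCast (show p ∣ q p by simp [q, h]) a
    have h2 : (a : ℂ_[p]) = intEmb p (a : ℤ_[p]) := by simp
    have hq : (q p : ℝ) = p := by simp [q, h]
    rw [h1, h2, ← map_sub, key, hq]
    have h3 : teichmullerLift p (a : ZMod p) - (a : ℤ_[p]) = WittVector.equiv p
        (WittVector.teichmuller p (a : ZMod p) - (a : WittVector p (ZMod p))) := by
      rw [map_sub, map_natCast (WittVector.equiv p)]
      rfl
    have h4 : ‖teichmullerLift p (a : ZMod p) - (a : ℤ_[p])‖ < 1 := by
      refine lt_of_le_of_ne (PadicInt.norm_le_one _) fun h5 => ?_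
      rw [← PadicInt.isUnit_iff, h3, isUnit_map_iff] at h5
      have h6 := h5.map (WittVector.constantCoeff (p := p) (R := ZMod p))
      rw [map_sub, map_natCast WittVector.constantCoeff] at h6
      have h7 : WittVector.constantCoeff (WittVector.teichmuller p (a : ZMod p)) =
          (a : ZMod p) := WittVector.teichmuller_coeff_zero p _
      rw [h7, sub_self] at h6
      exact not_isUnit_zero h6
    have h8 := (PadicInt.norm_le_pow_iff_norm_lt_pow_add_one
      (teichmullerLift p (a : ZMod p) - (a : ℤ_[p])) (-1)).mpr (by simpa using h4)
    simpa using h8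

end

end KubotaLeopoldt

/-!
The regularized function `-(1 - χ(c)⟨c⟩ ^ (1 - s)) L_p(s, χ)` is the integral of
`χω⁻¹(a) ⟨a⟩ ^ (-s)` against the distribution `ε_{a,c,F}`, and the sum over `1 ≤ a ≤ F` in the
theorem is the Riemann sum modulo `F` of this integral.

*The integral.* The numbers `ε_{a,c,F}` are compatible when `F` is replaced by a multiple
(`epsSum_mul_of_periodic`): multiplication by `c` permutes the residues modulo `F`
(`sum_add_mul_carry`), and `ε` records the carries. They have norm at most `p`, so the Riemann sums
of `χω⁻¹(a) (⟨a⟩ - 1) ^ n` modulo `F p ^ N` converge. Their limits are the coefficients of a Newton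
series `∑ binom (-s) n * x n`, which is a power series on the disc because `x n` is of size
`q ^ (-n)` (`NewtonBound.analyticOnDisc`). Comparing this series term by term with the expansion
of the sum modulo `F` gives the bound `‖F / (q p)‖` (`norm_epsIntegral_sub_dirichletSum_le`).

*The `p`-adic `L`-function.* Similarly `(s - 1) L_p(s, χ)` is the `p`-adic mean of
`χ(t) ⟨t⟩ ^ (1 - s)`, with a Newton series whose coefficients are means of
`χ(t) (⟨t⟩ - 1) ^ n`. These means are finite sums of Bernoulli numbers by Faulhaber's formula, and
the theorem of von Staudt and Clausen bounds them. At `s = 1 - m` the function is the mean of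
`χω⁻ᵐ(t) t ^ m` over `t` prime to `p`, that is, a generalized Bernoulli number without its Euler
factor (`tendsto_mean_twistFun`). For `χ ≠ 1` the constant coefficient vanishes, and each binomial
coefficient of the remaining series is divisible by `s - 1`, so that there is no pole.

*The comparison.* Expanding `(b + F k) ^ m` to first order in `F` for `c t = b + F k` evaluates the
integral at `s = 1 - m` (`tendsto_epsSum_twistFun`). Hence the integral and the regularized
function agree at the points `-p ^ k = 1 - (p ^ k + 1)`. These accumulate at `0`, the centre of the
disc, so the identity theorem for power series makes the two functions equal
(`regularizedL_eq_epsIntegral`). The integral has no pole, which yields the limit at `s = 1`.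
-/

namespace KubotaLeopoldt

open Finset Filter

variable {p : ℕ} [hp : Fact p.Prime]

/-! ### Norms of rational integers and the radius of the disc -/

section Norms

theorem norm_natCast_eq_padic (n : ℕ) : ‖(n : ℂ_[p])‖ = ‖(n : ℚ_[p])‖ := by
  rw [← PadicComplex.norm_extends' p (n : ℚ_[p])]
  simp

theorem norm_natCast_le_one (n : ℕ) : ‖(n : ℂ_[p])‖ ≤ 1 :=
  IsUltrametricDist.norm_natCast_le_one ℂ_[p] n

theorem norm_sub_le_max (x y : ℂ_[p]) : ‖x - y‖ ≤ max ‖x‖ ‖y‖ := by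
  simpa [sub_eq_add_neg] using IsUltrametricDist.norm_add_le_max x (-y)

theorem norm_p : ‖(p : ℂ_[p])‖ = (p : ℝ)⁻¹ := by
  rw [norm_natCast_eq_padic, Padic.norm_p]

theorem one_lt_p : (1 : ℝ) < p := by exact_mod_cast hp.out.one_lt

theorem p_pos : (0 : ℝ) < p := by exact_mod_cast hp.out.pos

variable (p) in
theorem p_dvd_q : p ∣ q p := by
  unfold q
  split_ifs with h
  · subst h; norm_num
  · exact dvd_rfl

variable (p) in
theorem q_dvd_sq : q p ∣ p ^ 2 := by
  unfold q
  split_ifs with h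
  · subst h; norm_num
  · exact dvd_pow_self p two_ne_zero

variable (p) in
theorem three_le_q : 3 ≤ q p := by
  unfold q
  split_ifs with h
  · norm_num
  · have := hp.out.two_le
    omega

variable (p) in
theorem q_pos : (0 : ℝ) < q p := by
  have := three_le_q p
  exact_mod_cast (by omega : 0 < q p)

theorem norm_q : ‖(q p : ℂ_[p])‖ = (q p : ℝ)⁻¹ := by
  unfold q
  split_ifs with h
  · subst h
    have : ((4 : ℕ) : ℂ_[2]) = ((2 : ℕ) : ℂ_[2]) ^ 2 := by norm_num
    rw [this, norm_pow, norm_p]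
    norm_num
  · exact norm_p

theorem inv_norm_natCast_le {n : ℕ} (hn : n ≠ 0) : ‖(n : ℂ_[p])‖⁻¹ ≤ n := by
  rw [norm_natCast_eq_padic, Padic.norm_eq_zpow_neg_valuation (by exact_mod_cast hn),
    Padic.valuation_natCast, zpow_neg, inv_inv, zpow_natCast]
  exact_mod_cast Nat.le_of_dvd (Nat.pos_of_ne_zero hn) pow_padicValNat_dvd

theorem norm_natCast_le_of_dvd {a b : ℕ} (h : a ∣ b) : ‖(b : ℂ_[p])‖ ≤ ‖(a : ℂ_[p])‖ := by
  obtain ⟨k, rfl⟩ := h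
  rw [Nat.cast_mul, norm_mul]
  exact mul_le_of_le_one_right (norm_nonneg _) (norm_natCast_le_one k)

/-- The number `ρ = p ^ (1 / (p - 1))`, whose powers bound `|n!|⁻¹`. -/
noncomputable def rho (p : ℕ) : ℝ := (p : ℝ) ^ ((1 : ℝ) / ((p : ℝ) - 1))

theorem one_lt_rho : 1 < rho p :=
  Real.one_lt_rpow one_lt_p (div_pos one_pos (sub_pos.mpr one_lt_p))

theorem rho_pow : rho p ^ (p - 1) = p := by
  rw [rho, ← Real.rpow_natCast, ← Real.rpow_mul p_pos.le, Nat.cast_sub hp.out.one_le,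
    Nat.cast_one, one_div_mul_cancel (sub_pos.mpr one_lt_p).ne', Real.rpow_one]

theorem radius_eq : radius p = q p / rho p := by
  rw [radius, rho, neg_div, Real.rpow_neg p_pos.le, div_eq_mul_inv (q p : ℝ)]

theorem one_lt_radius : 1 < radius p := by
  rw [radius_eq, one_lt_div (one_pos.trans one_lt_rho)]
  unfold q
  split_ifs with h
  · subst h
    have := rho_pow (p := 2)
    norm_num at this ⊢
    rw [this]
    norm_num
  · have h3 : 2 ≤ p - 1 := by
      have := hp.out.two_le
      omega
    -- for odd `p` the exponent `p - 1` is at least `2`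
    calc rho p < rho p ^ (p - 1) := lt_self_pow₀ one_lt_rho (by omega)
      _ = p := rho_pow

/-- By Legendre's formula `n!` has valuation at most `n / (p - 1)`. -/
theorem inv_norm_factorial_le (n : ℕ) : ‖(n.factorial : ℂ_[p])‖⁻¹ ≤ rho p ^ n := by
  rw [norm_natCast_eq_padic,
    Padic.norm_eq_zpow_neg_valuation (by exact_mod_cast n.factorial_ne_zero),
    Padic.valuation_natCast, zpow_neg, inv_inv, zpow_natCast]
  nth_rw 1 [← rho_pow (p := p)]
  rw [← pow_mul]
  refine pow_le_pow_right₀ one_lt_rho.le ?_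
  rw [sub_one_mul_padicValNat_factorial]
  exact Nat.sub_le _ _

end Norms

/-! ### Power series on the disc -/

section PowerSeries

/-- `g` is given on the disc `‖s‖ < radius p` by a power series that converges absolutely at every
smaller radius. Absolute convergence makes products of such functions again of this kind. -/
def AnalyticOnDisc (g : ℂ_[p] → ℂ_[p]) : Prop :=
  ∃ b : ℕ → ℂ_[p], (∀ r : ℝ, 0 ≤ r → r < radius p → Summable fun n => ‖b n‖ * r ^ n) ∧
    ∀ s : ℂ_[p], ‖s‖ < radius p → HasSum (fun n => b n * s ^ n) (g s)

theorem analyticOnDisc_const (a : ℂ_[p]) : AnalyticOnDisc fun _ => a := by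
  refine ⟨fun n => if n = 0 then a else 0, fun r _ _ => ?_, fun s _ => ?_⟩
  · refine summable_of_ne_finset_zero (s := {0}) fun n hn => ?_
    simp only [if_neg (fun h => hn (mem_singleton.mpr h)), norm_zero, zero_mul]
  · have := hasSum_single (f := fun n => (if n = 0 then a else 0) * s ^ n) 0 fun n hn => by
      rw [if_neg hn, zero_mul]
    simpa using this

theorem analyticOnDisc_id : AnalyticOnDisc fun s : ℂ_[p] => s := by
  refine ⟨fun n => if n = 1 then 1 else 0, fun r _ _ => ?_, fun s _ => ?_⟩
  · refine summable_of_ne_finset_zero (s := {1}) fun n hn => ?_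
    simp only [if_neg (fun h => hn (mem_singleton.mpr h)), norm_zero, zero_mul]
  · have := hasSum_single (f := fun n => (if n = 1 then (1 : ℂ_[p]) else 0) * s ^ n) 1
      fun n hn => by rw [if_neg hn, zero_mul]
    simpa using this

theorem AnalyticOnDisc.sub {g h : ℂ_[p] → ℂ_[p]} (hg : AnalyticOnDisc g)
    (hh : AnalyticOnDisc h) : AnalyticOnDisc fun s => g s - h s := by
  obtain ⟨b, hb, hb'⟩ := hg
  obtain ⟨d, hd, hd'⟩ := hh
  refine ⟨fun n => b n - d n, fun r h0 hr => ?_, fun s hs => ?_⟩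
  · refine Summable.of_nonneg_of_le (fun n => by positivity) (fun n => ?_)
      ((hb r h0 hr).add (hd r h0 hr))
    rw [← add_mul]
    gcongr
    exact norm_sub_le _ _
  · simpa only [sub_mul] using (hb' s hs).sub (hd' s hs)

theorem AnalyticOnDisc.mul {g h : ℂ_[p] → ℂ_[p]} (hg : AnalyticOnDisc g)
    (hh : AnalyticOnDisc h) : AnalyticOnDisc fun s => g s * h s := by
  obtain ⟨b, hb, hb'⟩ := hg
  obtain ⟨d, hd, hd'⟩ := hh
  refine ⟨fun n => ∑ kl ∈ antidiagonal n, b kl.1 * d kl.2, fun r h0 hr => ?_, fun s hs => ?_⟩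
  · have h1 := summable_norm_sum_mul_antidiagonal_of_summable_norm
      (f := fun n => ‖b n‖ * r ^ n) (g := fun n => ‖d n‖ * r ^ n)
      (by simpa [abs_of_nonneg h0] using hb r h0 hr) (by simpa [abs_of_nonneg h0] using hd r h0 hr)
    refine Summable.of_nonneg_of_le (fun n => by positivity) (fun n => ?_) h1
    refine le_trans ?_ (le_abs_self _)
    calc ‖∑ kl ∈ antidiagonal n, b kl.1 * d kl.2‖ * r ^ n
        ≤ (∑ kl ∈ antidiagonal n, ‖b kl.1 * d kl.2‖) * r ^ n := by
          gcongr
          exact norm_sum_le _ _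
      _ = _ := by
          rw [sum_mul]
          refine sum_congr rfl fun kl hkl => ?_
          rw [← mem_antidiagonal.mp hkl, norm_mul, pow_add]
          ring
  · have h1 : Summable fun n => ‖b n * s ^ n‖ := by
      simpa only [norm_mul, norm_pow] using hb ‖s‖ (norm_nonneg _) hs
    have h2 : Summable fun n => ‖d n * s ^ n‖ := by
      simpa only [norm_mul, norm_pow] using hd ‖s‖ (norm_nonneg _) hs
    have h3 : (fun n => (∑ kl ∈ antidiagonal n, b kl.1 * d kl.2) * s ^ n) =
        fun n => ∑ kl ∈ antidiagonal n, b kl.1 * s ^ kl.1 * (d kl.2 * s ^ kl.2) := by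
      funext n
      rw [sum_mul]
      refine sum_congr rfl fun kl hkl => ?_
      rw [← mem_antidiagonal.mp hkl, pow_add]
      ring
    beta_reduce
    rw [h3, ← (hb' s hs).tsum_eq, ← (hd' s hs).tsum_eq,
      tsum_mul_tsum_eq_tsum_sum_antidiagonal_of_summable_norm h1 h2]
    exact (summable_norm_sum_mul_antidiagonal_of_summable_norm h1 h2).of_norm.hasSum

theorem AnalyticOnDisc.isPowerSeriesOn {g : ℂ_[p] → ℂ_[p]} (hg : AnalyticOnDisc g)
    (P : ℂ_[p] → Prop) : IsPowerSeriesOn P g := by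
  obtain ⟨b, -, hb⟩ := hg
  exact ⟨b, fun s hs => ⟨g s, hb s hs, fun _ => rfl⟩⟩

/-- The radius of the disc exceeds `1`, so that `1` is an inner point. -/
theorem AnalyticOnDisc.continuousAt_one {g : ℂ_[p] → ℂ_[p]} (hg : AnalyticOnDisc g) :
    ContinuousAt g 1 := by
  obtain ⟨b, hb, hb'⟩ := hg
  obtain ⟨r, hr1, hr⟩ := exists_between (one_lt_radius (p := p))
  have hc : ContinuousOn (fun s : ℂ_[p] => ∑' n, b n * s ^ n) (Metric.ball 0 r) := by
    refine continuousOn_tsum (fun n => by fun_prop) (hb r (by linarith) hr) fun n s hs => ?_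
    rw [norm_mul, norm_pow]
    gcongr
    exact (mem_ball_zero_iff.mp hs).le
  have hmem : Metric.ball (0 : ℂ_[p]) r ∈ 𝓝 1 :=
    Metric.isOpen_ball.mem_nhds (by simpa using hr1)
  refine (hc.continuousAt hmem).congr ?_
  filter_upwards [hmem] with s hs
  exact (hb' s ((mem_ball_zero_iff.mp hs).trans hr)).tsum_eq

/-- The points `-p ^ k = 1 - (p ^ k + 1)` tend to `0`. -/
theorem tendsto_neg_p_pow : Tendsto (fun k : ℕ => -(p : ℂ_[p]) ^ k) atTop (𝓝[≠] 0) := by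
  refine tendsto_nhdsWithin_iff.mpr ⟨?_, Eventually.of_forall fun k => ?_⟩
  · have : ‖(p : ℂ_[p])‖ < 1 := by
      rw [norm_p]
      exact inv_lt_one_of_one_lt₀ one_lt_p
    simpa using (tendsto_pow_atTop_nhds_zero_of_norm_lt_one this).neg
  · have : (p : ℂ_[p]) ≠ 0 := by exact_mod_cast hp.out.ne_zero
    exact neg_ne_zero.mpr (pow_ne_zero k this)

theorem norm_neg_p_pow_lt_radius (k : ℕ) : ‖-(p : ℂ_[p]) ^ k‖ < radius p := by
  rw [norm_neg, norm_pow]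
  exact (pow_le_one₀ (norm_nonneg _) (norm_natCast_le_one p)).trans_lt one_lt_radius

theorem coeff_eq_of_frequently_eq {𝕜 : Type*} [NontriviallyNormedField 𝕜] [CompleteSpace 𝕜]
    {b d : ℕ → 𝕜} {g h : 𝕜 → 𝕜} (hb : ∀ᶠ z in 𝓝 0, HasSum (fun n => b n * z ^ n) (g z))
    (hd : ∀ᶠ z in 𝓝 0, HasSum (fun n => d n * z ^ n) (h z))
    (heq : ∃ᶠ z in 𝓝[≠] 0, g z = h z) : b = d := by
  have key : ∀ (e : ℕ → 𝕜) (u : 𝕜 → 𝕜), (∀ᶠ z in 𝓝 0, HasSum (fun n => e n * z ^ n) (u z)) →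
      HasFPowerSeriesAt u (FormalMultilinearSeries.ofScalars 𝕜 e) 0 := by
    intro e u he
    rw [hasFPowerSeriesAt_iff]
    filter_upwards [he] with z hz
    simpa [FormalMultilinearSeries.coeff_ofScalars, mul_comm] using hz
  have hg := key b g hb
  have hh := key d h hd
  have hev := (hg.analyticAt.frequently_eq_iff_eventually_eq hh.analyticAt).mp heq
  exact FormalMultilinearSeries.ofScalars_series_injective 𝕜 𝕜
    (hg.eq_formalMultilinearSeries_of_eventually hh hev)

/-- Identity theorem: two power series that converge on the disc and take the same values at
the points `-p ^ k`, which accumulate at the centre, have the same coefficients. -/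
theorem coeff_eq_of_eq_at_neg_p_pow {b d : ℕ → ℂ_[p]} {g h : ℂ_[p] → ℂ_[p]}
    (hb : ∀ s : ℂ_[p], ‖s‖ < radius p → HasSum (fun n => b n * s ^ n) (g s))
    (hd : ∀ s : ℂ_[p], ‖s‖ < radius p → HasSum (fun n => d n * s ^ n) (h s))
    (heq : ∀ k : ℕ, g (-(p : ℂ_[p]) ^ k) = h (-(p : ℂ_[p]) ^ k)) : b = d := by
  have hball : ∀ᶠ z : ℂ_[p] in 𝓝 0, ‖z‖ < radius p := by
    have := Metric.ball_mem_nhds (0 : ℂ_[p]) (one_pos.trans (one_lt_radius (p := p)))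
    filter_upwards [this] with z hz
    exact mem_ball_zero_iff.mp hz
  refine coeff_eq_of_frequently_eq (hball.mono hb) (hball.mono hd) ?_
  exact tendsto_neg_p_pow.frequently (Frequently.of_forall heq)

theorem AnalyticOnDisc.eqOn {g h : ℂ_[p] → ℂ_[p]} (hg : AnalyticOnDisc g)
    (hh : AnalyticOnDisc h) (heq : ∀ k : ℕ, g (-(p : ℂ_[p]) ^ k) = h (-(p : ℂ_[p]) ^ k))
    {s : ℂ_[p]} (hs : ‖s‖ < radius p) : g s = h s := by
  obtain ⟨b, -, hb⟩ := hg
  obtain ⟨d, -, hd⟩ := hh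
  obtain rfl := coeff_eq_of_eq_at_neg_p_pow hb hd heq
  exact (hb s hs).unique (hd s hs)

/-- Identity theorem for a function that is given by a convergent power series only at the points
of the disc that satisfy `P`. -/
theorem IsPowerSeriesOn.eqOn {P : ℂ_[p] → Prop} {g h : ℂ_[p] → ℂ_[p]}
    (hg : IsPowerSeriesOn P g) (hh : AnalyticOnDisc h) (hP : ∀ k : ℕ, P (-(p : ℂ_[p]) ^ k))
    (heq : ∀ k : ℕ, g (-(p : ℂ_[p]) ^ k) = h (-(p : ℂ_[p]) ^ k))
    {s : ℂ_[p]} (hs : ‖s‖ < radius p) (hPs : P s) : g s = h s := by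
  obtain ⟨b, hb⟩ := hg
  obtain ⟨d, -, hd⟩ := hh
  have hb' : ∀ s : ℂ_[p], ‖s‖ < radius p →
      HasSum (fun n => b n * s ^ n) (∑' n, b n * s ^ n) := fun s hs => by
    obtain ⟨t, ht, -⟩ := hb s hs
    exact ht.summable.hasSum
  have hval : ∀ s : ℂ_[p], ‖s‖ < radius p → P s → g s = ∑' n, b n * s ^ n := fun s hs hPs => by
    obtain ⟨t, ht, h⟩ := hb s hs
    rw [h hPs, ht.tsum_eq]
  obtain rfl := coeff_eq_of_eq_at_neg_p_pow hb' hd fun k => by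
    rw [← hval _ (norm_neg_p_pow_lt_radius k) (hP k), heq]
  rw [hval s hs hPs]
  exact (hd s hs).tsum_eq

end PowerSeries

/-! ### Newton series -/

section Newton

theorem binom_natCast (m n : ℕ) : binom p (m : ℂ_[p]) n = (m.choose n : ℂ_[p]) := by
  have h : (n.factorial : ℂ_[p]) ≠ 0 := by exact_mod_cast n.factorial_ne_zero
  rw [binom, div_eq_iff h, mul_comm, ← Nat.cast_mul, ← Nat.descFactorial_eq_factorial_mul_choose,
    ← descPochhammer_eval_eq_descFactorial, descPochhammer_eval_eq_prod_range]

theorem norm_binom_le (s : ℂ_[p]) (n : ℕ) :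
    ‖binom p s n‖ ≤ rho p ^ n * max 1 ‖s‖ ^ n := by
  rw [binom, norm_div, div_eq_inv_mul, norm_prod]
  refine mul_le_mul (inv_norm_factorial_le n) ?_ (by positivity)
    (pow_nonneg (one_pos.trans one_lt_rho).le _)
  refine (prod_le_prod (fun _ _ => norm_nonneg _) fun i _ => ?_).trans_eq
    (by rw [prod_const, card_range])
  refine (norm_sub_le_max _ _).trans ?_
  rw [max_comm]
  exact max_le_max (norm_natCast_le_one i) le_rfl

theorem norm_binom_le_q_pow {s : ℂ_[p]} (hs : ‖s‖ < radius p) (n : ℕ) :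
    ‖binom p s n‖ ≤ (q p : ℝ) ^ n := by
  have h0 : 0 < rho p := one_pos.trans one_lt_rho
  refine (norm_binom_le s n).trans ?_
  rw [← mul_pow]
  refine pow_le_pow_left₀ (by positivity) ?_ n
  rw [mul_comm, ← le_div_iff₀ h0, ← radius_eq]
  exact max_le one_lt_radius.le hs.le

/-- The growth condition on the coefficients `x n` of a Newton series `∑ binom s n * x n` under
which it converges on the disc `‖s‖ < radius p`. -/
def NewtonBound (x : ℕ → ℂ_[p]) : Prop :=
  ∃ C : ℝ, 0 ≤ C ∧ ∀ n, ‖x n‖ ≤ C * (n + 1) * (q p : ℝ)⁻¹ ^ n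

theorem rho_pow_mul_q_inv_pow (n : ℕ) :
    rho p ^ n * (q p : ℝ)⁻¹ ^ n = (radius p)⁻¹ ^ n := by
  rw [radius_eq, inv_div, div_eq_mul_inv, mul_pow]

theorem summable_sq_mul_div_radius {r : ℝ} (h0 : 0 ≤ r) (hr : r < radius p) (C : ℝ) :
    Summable fun n : ℕ => C * ((n : ℝ) + 1) * ((n + 1) * ((radius p)⁻¹ * r) ^ n) := by
  have hR : 0 < radius p := one_pos.trans one_lt_radius
  have ht : ‖(radius p)⁻¹ * r‖ < 1 := by
    rw [Real.norm_of_nonneg (by positivity), inv_mul_lt_iff₀ hR, mul_one]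
    exact hr
  have h2 := summable_pow_mul_geometric_of_norm_lt_one 2 ht
  have h1 := summable_pow_mul_geometric_of_norm_lt_one 1 ht
  have h0 := summable_pow_mul_geometric_of_norm_lt_one 0 ht
  refine (((h2.add (h1.mul_left 2)).add h0).mul_left C).congr fun n => ?_
  ring

theorem NewtonBound.summable {x : ℕ → ℂ_[p]} (hx : NewtonBound x) {s : ℂ_[p]}
    (hs : ‖s‖ < radius p) : Summable fun n => binom p s n * x n := by
  obtain ⟨C, hC, hx⟩ := hx
  have hR : 0 < radius p := one_pos.trans one_lt_radius
  have hr0 : 0 < rho p := one_pos.trans one_lt_rho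
  refine Summable.of_norm_bounded (summable_sq_mul_div_radius (r := max 1 ‖s‖) (by positivity)
    (max_lt one_lt_radius hs) C) fun n => ?_
  rw [norm_mul]
  calc ‖binom p s n‖ * ‖x n‖
      ≤ (rho p ^ n * max 1 ‖s‖ ^ n) * (C * (n + 1) * (q p : ℝ)⁻¹ ^ n) := by
        gcongr
        · exact norm_binom_le s n
        · exact hx n
    _ = C * (n + 1) * (1 * ((radius p)⁻¹ * max 1 ‖s‖) ^ n) := by
        rw [mul_pow (radius p)⁻¹, ← rho_pow_mul_q_inv_pow]
        ring
    _ ≤ _ := by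
        gcongr
        simp

/-- The binomial coefficient `binom (β - s) n` as a polynomial in `s`. -/
noncomputable def binomPoly (β : ℂ_[p]) (n : ℕ) : Polynomial ℂ_[p] :=
  Polynomial.C (n.factorial : ℂ_[p])⁻¹ *
    ∏ i ∈ range n, (Polynomial.C (β - i) - Polynomial.X)

theorem binomPoly_eval (β s : ℂ_[p]) (n : ℕ) :
    (binomPoly β n).eval s = binom p (β - s) n := by
  rw [binomPoly, binom, Polynomial.eval_mul, Polynomial.eval_prod, Polynomial.eval_C,
    div_eq_inv_mul]
  congr 1
  refine prod_congr rfl fun i _ => ?_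
  simp
  ring

theorem binomPoly_coeff_eq_zero (β : ℂ_[p]) {n k : ℕ} (h : n < k) :
    (binomPoly β n).coeff k = 0 := by
  refine Polynomial.coeff_eq_zero_of_natDegree_lt (lt_of_le_of_lt ?_ h)
  refine (Polynomial.natDegree_C_mul_le _ _).trans ((Polynomial.natDegree_prod_le _ _).trans ?_)
  refine (sum_le_card_nsmul _ _ 1 fun i _ => ?_).trans (by simp)
  exact (Polynomial.natDegree_sub_le _ _).trans
    (max_le (by rw [Polynomial.natDegree_C]; exact Nat.zero_le _) Polynomial.natDegree_X_le)

theorem norm_binomPoly_coeff_le {β : ℂ_[p]} (hβ : ‖β‖ ≤ 1) (n k : ℕ) :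
    ‖(binomPoly β n).coeff k‖ ≤ rho p ^ n := by
  have key : ∀ m k : ℕ,
      ‖(∏ i ∈ range m, (Polynomial.C (β - i) - Polynomial.X)).coeff k‖ ≤ 1 := by
    intro m
    induction m with
    | zero =>
      intro k
      rw [prod_range_zero, Polynomial.coeff_one]
      split_ifs <;> simp
    | succ m ih =>
      intro k
      have h1 : ‖β - m‖ ≤ 1 :=
        (norm_sub_le_max _ _).trans (max_le hβ (norm_natCast_le_one m))
      rw [prod_range_succ, mul_sub, Polynomial.coeff_sub, Polynomial.coeff_mul_C]
      refine (norm_sub_le_max _ _).trans (max_le ?_ ?_)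
      · rw [norm_mul]
        exact mul_le_one₀ (ih k) (norm_nonneg _) h1
      · cases k with
        | zero => simp
        | succ k =>
          rw [Polynomial.coeff_mul_X]
          exact ih k
  rw [binomPoly, Polynomial.coeff_C_mul, norm_mul, norm_inv]
  exact (mul_le_of_le_one_right (by positivity) (key n k)).trans (inv_norm_factorial_le n)

/-- A Newton series in `β - s` is a power series in `s`: the double series obtained by expanding
the binomial coefficients converges absolutely, since their coefficients have norm at most
`|n!|⁻¹`. -/
theorem NewtonBound.analyticOnDisc {x : ℕ → ℂ_[p]} (hx : NewtonBound x) {β : ℂ_[p]}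
    (hβ : ‖β‖ ≤ 1) : AnalyticOnDisc fun s => ∑' n, binom p (β - s) n * x n := by
  obtain ⟨C, hC, hx⟩ := hx
  have hR : 0 < radius p := one_pos.trans one_lt_radius
  have hr0 : 0 < rho p := one_pos.trans one_lt_rho
  set a : ℕ × ℕ → ℂ_[p] := fun nk => (binomPoly β nk.1).coeff nk.2 * x nk.1 with ha
  have hzero : ∀ n k, k ∉ range (n + 1) → a (n, k) = 0 := fun n k hk => by
    rw [mem_range, not_lt] at hk
    simp only [ha]
    rw [binomPoly_coeff_eq_zero β (by omega), zero_mul]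
  have hsum : ∀ r : ℝ, 0 ≤ r → r < radius p →
      Summable fun nk : ℕ × ℕ => ‖a nk‖ * r ^ nk.2 := by
    intro r h0 hr
    have hz : ∀ n k, k ∉ range (n + 1) → ‖a (n, k)‖ * r ^ k = 0 := fun n k hk => by
      rw [hzero n k hk, norm_zero, zero_mul]
    rw [summable_prod_of_nonneg fun nk => by positivity]
    refine ⟨fun n => summable_of_ne_finset_zero (hz n), ?_⟩
    refine Summable.of_nonneg_of_le (fun n => tsum_nonneg fun k => by positivity) (fun n => ?_)
      (summable_sq_mul_div_radius (r := max 1 r) (by positivity) (max_lt one_lt_radius hr) C)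
    rw [tsum_eq_sum (hz n)]
    refine (sum_le_card_nsmul _ _
      (rho p ^ n * (C * (n + 1) * (q p : ℝ)⁻¹ ^ n) * max 1 r ^ n) fun k hk => ?_).trans_eq ?_
    · rw [mem_range, Nat.lt_succ_iff] at hk
      simp only [ha, norm_mul]
      have h1 : r ^ k ≤ max 1 r ^ n :=
        (pow_le_pow_left₀ h0 (le_max_right _ _) k).trans
          (pow_le_pow_right₀ (le_max_left _ _) hk)
      gcongr
      · exact norm_binomPoly_coeff_le hβ n k
      · exact hx n
    · rw [card_range, nsmul_eq_mul, mul_pow (radius p)⁻¹, ← rho_pow_mul_q_inv_pow]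
      push_cast
      ring
  have hcol : ∀ k, Summable fun n => ‖a (n, k)‖ := fun k => by
    have h1 := (hsum 1 zero_le_one one_lt_radius).prod_symm.prod_factor k
    simpa using h1
  refine ⟨fun k => ∑' n, a (n, k), fun r h0 hr => ?_, fun s hs => ?_⟩
  · have h1 := (hsum r h0 hr).prod_symm.prod
    refine Summable.of_nonneg_of_le (fun k => by positivity) (fun k => ?_) h1
    simp only [Prod.swap_prod_mk]
    rw [tsum_mul_right]
    gcongr
    exact norm_tsum_le_tsum_norm (hcol k)
  · have h1 : Summable fun nk : ℕ × ℕ => a nk * s ^ nk.2 := by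
      refine Summable.of_norm ?_
      simpa only [norm_mul, norm_pow] using hsum ‖s‖ (norm_nonneg _) hs
    have h2 : ∀ n, ∑' k, a (n, k) * s ^ k = binom p (β - s) n * x n := fun n => by
      rw [tsum_eq_sum (s := range (n + 1)) fun k hk => by rw [hzero n k hk, zero_mul],
        ← binomPoly_eval,
        Polynomial.eval_eq_sum_range' (n := n + 1)
          (Nat.lt_succ_of_le (Polynomial.natDegree_le_iff_coeff_eq_zero.mpr
            fun k hk => binomPoly_coeff_eq_zero β hk)), sum_mul]
      refine sum_congr rfl fun k _ => ?_
      simp only [ha]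
      ring
    have h3 := h1.prod_symm.hasSum.prod_fiberwise fun k => (h1.prod_symm.prod_factor k).hasSum
    have h4 : ∑' nk : ℕ × ℕ, a nk.swap * s ^ nk.swap.2 = ∑' n, binom p (β - s) n * x n := by
      rw [show ∑' nk : ℕ × ℕ, a nk.swap * s ^ nk.swap.2 = ∑' nk : ℕ × ℕ, a nk * s ^ nk.2 from
        (Equiv.prodComm ℕ ℕ).tsum_eq (fun nk : ℕ × ℕ => a nk * s ^ nk.2), h1.tsum_prod]
      exact tsum_congr h2
    rw [h4] at h3
    refine h3.congr_fun ?_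
    intro k
    simp [tsum_mul_right]

end Newton

/-! ### Multiplication by `c` on residues and the distribution `ε` -/

section Distribution

theorem sum_Icc_mul {A : Type*} [AddCommMonoid A] (m M : ℕ) (Φ : ℕ → A) :
    ∑ t ∈ Icc 1 (m * M), Φ t = ∑ j ∈ range M, ∑ a ∈ Icc 1 m, Φ (a + m * j) := by
  have h : ∀ n (Ψ : ℕ → A), ∑ t ∈ Icc 1 n, Ψ t = ∑ i ∈ range n, Ψ (i + 1) := fun n Ψ => by
    rw [range_eq_Ico, sum_Ico_add' Ψ 0 n 1]
    rfl
  induction M with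
  | zero => simp
  | succ M ih =>
    rw [sum_range_succ, ← ih, h, h, h, Nat.mul_succ, sum_range_add]
    congr 1
    refine sum_congr rfl fun i _ => ?_
    congr 1
    ring

/-- The digit `{-b F⁻¹}_c`, the representative `k` in `{0, …, c - 1}` of the residue class modulo
`c` for which `b + F k` is divisible by `c`. -/
def carry (c F b : ℕ) : ℕ := (-(b : ZMod c) * (F : ZMod c)⁻¹).val

theorem eps_natCast (c F b : ℕ) : eps (b : ℤ) c F = ((c : ℚ) - 1) / 2 - carry c F b := by
  rw [eps, carry, Int.cast_natCast]

theorem carry_lt {c : ℕ} (hc : 0 < c) (F b : ℕ) : carry c F b < c :=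
  have : NeZero c := ⟨hc.ne'⟩
  ZMod.val_lt _

theorem dvd_add_mul_carry {c F : ℕ} (hc : 0 < c) (hcF : c.Coprime F) (b : ℕ) :
    c ∣ b + F * carry c F b := by
  have : NeZero c := ⟨hc.ne'⟩
  rw [← ZMod.natCast_eq_zero_iff]
  push_cast
  rw [carry, ZMod.natCast_zmod_val]
  have := ZMod.coe_mul_inv_eq_one F hcF.symm
  linear_combination (-(b : ZMod c)) * this

/-- Multiplication by `c` permutes the residues modulo `F`: every `c * t` with `1 ≤ t ≤ F` is
`b + F * carry c F b` for exactly one `b` with `1 ≤ b ≤ F`. -/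
theorem sum_add_mul_carry {A : Type*} [AddCommMonoid A] {c F : ℕ} (hc : 0 < c)
    (hcF : c.Coprime F) (Φ : ℕ → A) :
    ∑ b ∈ Icc 1 F, Φ (b + F * carry c F b) = ∑ t ∈ Icc 1 F, Φ (c * t) := by
  have hdiv : ∀ b, c * ((b + F * carry c F b) / c) = b + F * carry c F b := fun b =>
    Nat.mul_div_cancel' (dvd_add_mul_carry hc hcF b)
  have hmaps : ∀ b ∈ Icc 1 F, (b + F * carry c F b) / c ∈ Icc 1 F := by
    intro b hb
    rw [mem_Icc] at hb ⊢
    constructor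
    · by_contra h
      have h0 : (b + F * carry c F b) / c = 0 := Nat.lt_one_iff.mp (not_le.mp h)
      have := hdiv b
      rw [h0] at this
      omega
    · refine Nat.div_le_of_le_mul ?_
      have h1 : carry c F b + 1 ≤ c := carry_lt hc F b
      calc b + F * carry c F b ≤ F + F * carry c F b := by omega
        _ = F * (carry c F b + 1) := by ring
        _ ≤ F * c := Nat.mul_le_mul_left F h1
        _ = c * F := mul_comm _ _
  have hinj : Set.InjOn (fun b => (b + F * carry c F b) / c) (Icc 1 F : Finset ℕ) := by
    intro b hb b' hb' h
    rw [mem_coe, mem_Icc] at hb hb'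
    have h1 : b + F * carry c F b = b' + F * carry c F b' := by
      rw [← hdiv b, ← hdiv b']
      exact congrArg (c * ·) h
    have h2 : b ≡ b' [MOD F] := by
      have := congrArg (· % F) h1
      simpa [Nat.ModEq] using this
    have h3 : b - 1 ≡ b' - 1 [MOD F] := by
      refine Nat.ModEq.add_right_cancel' 1 ?_
      rwa [Nat.sub_add_cancel hb.1, Nat.sub_add_cancel hb'.1]
    have := Nat.ModEq.eq_of_lt_of_lt h3 (by omega) (by omega)
    omega
  refine sum_nbij (fun b => (b + F * carry c F b) / c) hmaps hinj
    (surjOn_of_injOn_of_card_le _ hmaps hinj le_rfl) fun b _ => ?_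
  rw [hdiv]

theorem periodic_add_mul {A : Type*} {F : ℕ} {g : ℕ → A} (hg : ∀ a, g (a + F) = g a) (a j : ℕ) :
    g (a + F * j) = g a := by
  induction j with
  | zero => simp
  | succ j ih => rw [Nat.mul_succ, ← add_assoc, hg, ih]

/-- The first moment of the digits: `sum_add_mul_carry` for the function `g(x) x`. -/
theorem sum_mul_carry {K : Type*} [CommRing K] {c F : ℕ} (hc : 0 < c) (hcF : c.Coprime F)
    {g : ℕ → K} (hg : ∀ a, g (a + F) = g a) :
    F * ∑ b ∈ Icc 1 F, g b * carry c F b = ∑ t ∈ Icc 1 F, (c * g (c * t) - g t) * t := by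
  have h := sum_add_mul_carry hc hcF fun x => g x * (x : K)
  simp only [periodic_add_mul hg, Nat.cast_add, Nat.cast_mul, mul_add, sum_add_distrib] at h
  simp only [sub_mul, sum_sub_distrib]
  rw [eq_sub_iff_add_eq', mul_sum]
  convert h using 2
  · exact sum_congr rfl fun _ _ => by ring
  · ring

theorem sum_periodic_comp_mul {A : Type*} [AddCommMonoid A] {c F : ℕ} (hc : 0 < c)
    (hcF : c.Coprime F) {g : ℕ → A} (hg : ∀ a, g (a + F) = g a) :
    ∑ t ∈ Icc 1 F, g (c * t) = ∑ b ∈ Icc 1 F, g b := by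
  rw [← sum_add_mul_carry hc hcF]
  simp only [periodic_add_mul hg]

/-- The sum of `u(b) ε_{b,c,F}` over a system of residues modulo `F`. -/
noncomputable def epsSum (c F : ℕ) (u : ℕ → ℂ_[p]) : ℂ_[p] :=
  ∑ b ∈ Icc 1 F, u b * ((eps (b : ℤ) c F : ℚ) : ℂ_[p])

theorem epsSum_eq (c F : ℕ) (u : ℕ → ℂ_[p]) :
    epsSum c F u = ((c : ℂ_[p]) - 1) / 2 * ∑ b ∈ Icc 1 F, u b -
      ∑ b ∈ Icc 1 F, u b * carry c F b := by
  rw [epsSum, mul_sum, ← sum_sub_distrib]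
  refine sum_congr rfl fun b _ => ?_
  rw [eps_natCast]
  push_cast
  ring

/-- The numbers `ε_{a,c,F}` form a distribution in `a` modulo `F`: summing a periodic function
against them does not depend on the multiple of the period that is used. -/
theorem epsSum_mul_of_periodic {c F M : ℕ} (hc : 0 < c) (hF : F ≠ 0) (hM : M ≠ 0)
    (hcF : c.Coprime F) (hcM : c.Coprime M) {g : ℕ → ℂ_[p]} (hg : ∀ a, g (a + F) = g a) :
    epsSum c (F * M) g = epsSum c F g := by
  have hF' : (F : ℂ_[p]) ≠ 0 := by exact_mod_cast hF
  have hM' : (M : ℂ_[p]) ≠ 0 := by exact_mod_cast hM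
  have hgM : ∀ a, g (a + F * M) = g a := fun a => periodic_add_mul hg a M
  have hcg : ∀ a, g (c * (a + F)) = g (c * a) := fun a => by
    rw [mul_add, mul_comm c F, periodic_add_mul hg]
  have h1 := sum_mul_carry hc hcF hg
  have h2 := sum_mul_carry hc (hcF.mul_right hcM) hgM
  have h3 : ∑ b ∈ Icc 1 (F * M), g b = M * ∑ b ∈ Icc 1 F, g b := by
    rw [sum_Icc_mul]
    simp only [periodic_add_mul hg, sum_const, card_range, nsmul_eq_mul]
  have h4 : ∑ t ∈ Icc 1 F, ((c : ℂ_[p]) * g (c * t) - g t) = (c - 1) * ∑ b ∈ Icc 1 F, g b := by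
    rw [sum_sub_distrib, ← mul_sum, sum_periodic_comp_mul hc hcF hg]
    ring
  have h5 : ∑ t ∈ Icc 1 (F * M), ((c : ℂ_[p]) * g (c * t) - g t) * t =
      M * ∑ t ∈ Icc 1 F, ((c : ℂ_[p]) * g (c * t) - g t) * t +
        F * (∑ j ∈ range M, (j : ℂ_[p])) * ((c - 1) * ∑ b ∈ Icc 1 F, g b) := by
    rw [sum_Icc_mul, ← h4, ← nsmul_eq_mul, ← card_range M, ← sum_const, card_range,
      mul_sum (range M), sum_mul (range M), ← sum_add_distrib]
    refine sum_congr rfl fun j _ => ?_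
    rw [mul_sum, ← sum_add_distrib]
    refine sum_congr rfl fun a _ => ?_
    have : g (c * (a + F * j)) = g (c * a) :=
      periodic_add_mul (g := fun a => g (c * a)) hcg a j
    rw [this, periodic_add_mul hg]
    push_cast
    ring
  have h6 : (∑ j ∈ range M, (j : ℂ_[p])) = M * (M - 1) / 2 := by
    rw [eq_div_iff two_ne_zero, ← Nat.cast_sum, ← Nat.cast_two, ← Nat.cast_mul,
      sum_range_id_mul_two, Nat.cast_mul, Nat.cast_pred (Nat.pos_of_ne_zero hM)]
  rw [h5, ← h1, h6] at h2
  rw [epsSum_eq, epsSum_eq, h3]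
  refine mul_left_cancel₀ (mul_ne_zero hF' hM') ?_
  push_cast at h2
  linear_combination -h2

theorem norm_eps_le (a : ℤ) (c F : ℕ) : ‖((eps a c F : ℚ) : ℂ_[p])‖ ≤ p := by
  have h2 : ‖(2 : ℂ_[p])‖⁻¹ ≤ p := by
    have := inv_norm_natCast_le (p := p) two_ne_zero
    push_cast at this
    exact this.trans (by exact_mod_cast hp.out.two_le)
  set k := (-(a : ZMod c) * (F : ZMod c)⁻¹).val with hk
  have h : ((eps a c F : ℚ) : ℂ_[p]) = (((c : ℤ) - 1 - 2 * k : ℤ) : ℂ_[p]) / 2 := by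
    rw [eps, ← hk]
    push_cast
    ring
  rw [h, norm_div, div_eq_mul_inv]
  exact (mul_le_of_le_one_left (by positivity)
    (IsUltrametricDist.norm_intCast_le_one ℂ_[p] _)).trans h2

theorem norm_epsSum_le {c F : ℕ} {u : ℕ → ℂ_[p]} {B : ℝ} (hB : 0 ≤ B)
    (hu : ∀ a, ‖u a‖ ≤ B) : ‖epsSum c F u‖ ≤ B * p := by
  refine IsUltrametricDist.norm_sum_le_of_forall_le_of_nonneg (by positivity) fun b _ => ?_
  rw [norm_mul]
  exact mul_le_mul (hu b) (norm_eps_le _ _ _) (norm_nonneg _) hB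

theorem epsSum_sub (c F : ℕ) (u v : ℕ → ℂ_[p]) :
    epsSum c F u - epsSum c F v = epsSum c F fun a => u a - v a := by
  simp only [epsSum, sub_mul, sum_sub_distrib]

/-- Riemann sums of the distribution `ε` for a function that is constant up to `B` on residue
classes modulo `F`. -/
theorem norm_epsSum_mul_sub_le {c F M : ℕ} (hc : 0 < c) (hF : F ≠ 0) (hM : M ≠ 0)
    (hcF : c.Coprime F) (hcM : c.Coprime M) {u : ℕ → ℂ_[p]} {B : ℝ} (hB : 0 ≤ B)
    (hu : ∀ a j, ‖u (a + F * j) - u a‖ ≤ B) :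
    ‖epsSum c (F * M) u - epsSum c F u‖ ≤ B * p := by
  -- compare `u` with the periodic function `b ↦ u (b % F)`, whose sums do not depend on `M`
  have hdiff : ∀ b, ‖u b - u (b % F)‖ ≤ B := fun b => by
    conv_lhs => rw [← Nat.mod_add_div b F]
    simpa using hu (b % F) (b / F)
  have hper : epsSum c (F * M) (fun b => u (b % F)) = epsSum c F fun b => u (b % F) :=
    epsSum_mul_of_periodic hc hF hM hcF hcM fun a => by rw [Nat.add_mod_right]
  have h1 : epsSum c (F * M) u - epsSum c F u =
      epsSum c (F * M) (fun b => u b - u (b % F)) - epsSum c F (fun b => u b - u (b % F)) := by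
    rw [← epsSum_sub, ← epsSum_sub, hper]
    ring
  rw [h1]
  exact (norm_sub_le_max _ _).trans (max_le (norm_epsSum_le hB hdiff) (norm_epsSum_le hB hdiff))

end Distribution

/-! ### Bernoulli numbers as `p`-adic limits of power sums -/

section BernoulliLimits

/-- The `p`-adic size of Bernoulli numbers, from the theorem of von Staudt and Clausen. -/
theorem norm_bernoulli_le (n : ℕ) : ‖((bernoulli n : ℚ) : ℂ_[p])‖ ≤ p := by
  have h1p : (1 : ℝ) ≤ p := one_lt_p.le
  rcases Nat.even_or_odd' n with ⟨k, rfl | rfl⟩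
  · obtain ⟨z, hz⟩ := Bernoulli.vonStaudt_clausen k
    have h : ((bernoulli (2 * k) : ℚ) : ℂ_[p]) = (z : ℂ_[p]) -
        ∑ l ∈ range (2 * k + 2) with l.Prime ∧ (l - 1) ∣ 2 * k, (1 : ℂ_[p]) / (l : ℂ_[p]) := by
      have := congrArg (fun x : ℚ => (x : ℂ_[p])) hz
      push_cast at this
      rw [this]
      ring
    rw [h]
    refine (norm_sub_le_max _ _).trans (max_le
      ((IsUltrametricDist.norm_intCast_le_one ℂ_[p] z).trans h1p) ?_)
    refine IsUltrametricDist.norm_sum_le_of_forall_le_of_nonneg p_pos.le fun l hl => ?_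
    have hl' : l.Prime := (mem_filter.mp hl).2.1
    rw [norm_div, norm_one, one_div]
    by_cases hlp : l = p
    · subst hlp
      rw [norm_p, inv_inv]
    · rw [norm_natCast_eq_padic, (Padic.norm_natCast_eq_one_iff).mpr
        ((Nat.coprime_primes hp.out hl').mpr fun h => hlp h.symm), inv_one]
      exact h1p
  · rcases Nat.eq_zero_or_pos k with rfl | hk
    · have h : ((bernoulli (2 * 0 + 1) : ℚ) : ℂ_[p]) = -(((2 : ℕ) : ℂ_[p])⁻¹) := by
        rw [mul_zero, zero_add, bernoulli_one]
        push_cast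
        ring
      rw [h, norm_neg, norm_inv]
      exact (inv_norm_natCast_le two_ne_zero).trans (by exact_mod_cast hp.out.two_le)
    · rw [bernoulli_eq_zero_of_odd ⟨k, rfl⟩ (by omega)]
      simp

/-- Faulhaber's formula in the limit: the mean of `j ^ n` over `0 ≤ j < M` tends to `B_n` as
`M` tends to `0` `p`-adically. -/
theorem tendsto_mean_pow {M : ℕ → ℕ} (hM0 : ∀ N, M N ≠ 0)
    (hM : Tendsto (fun N => (M N : ℂ_[p])) atTop (𝓝 0)) (n : ℕ) :
    Tendsto (fun N => (M N : ℂ_[p])⁻¹ * ∑ j ∈ range (M N), (j : ℂ_[p]) ^ n) atTop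
      (𝓝 ((bernoulli n : ℚ) : ℂ_[p])) := by
  set P : ℂ_[p] → ℂ_[p] := fun x => ∑ i ∈ range (n + 1),
    ((bernoulli i : ℚ) : ℂ_[p]) * ((n + 1).choose i : ℂ_[p]) / ((n : ℂ_[p]) + 1) * x ^ (n - i)
    with hP
  have hn : (n : ℂ_[p]) + 1 ≠ 0 := by exact_mod_cast n.succ_ne_zero
  have hPc : Continuous P := by fun_prop
  have hP0 : P 0 = ((bernoulli n : ℚ) : ℂ_[p]) := by
    simp only [hP]
    rw [sum_range_succ, sum_eq_zero fun i hi => ?_]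
    · rw [Nat.sub_self, pow_zero, mul_one, zero_add, Nat.choose_succ_self_right]
      push_cast
      field_simp
    · have := mem_range.mp hi
      rw [zero_pow (by omega), mul_zero]
  have hlim := (hPc.tendsto 0).comp hM
  rw [hP0] at hlim
  refine hlim.congr fun N => ?_
  have hMN : (M N : ℂ_[p]) ≠ 0 := by exact_mod_cast hM0 N
  have h := congrArg (fun x : ℚ => (x : ℂ_[p])) (sum_range_pow (M N) n)
  push_cast at h
  rw [h, mul_sum]
  refine sum_congr rfl fun i hi => ?_
  have hi' : n + 1 - i = n - i + 1 := by
    have := mem_range.mp hi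
    omega
  rw [hi', pow_succ]
  field_simp

/-- The value `∑ i, (n choose i) z ^ i B_i y ^ (n - i)`, symbolically `(y + z B) ^ n`. -/
noncomputable def bernoulliForm (n : ℕ) (y z : ℂ_[p]) : ℂ_[p] :=
  ∑ i ∈ range (n + 1), z ^ i * y ^ (n - i) * (n.choose i : ℂ_[p]) * ((bernoulli i : ℚ) : ℂ_[p])

theorem tendsto_mean_linear_pow {M : ℕ → ℕ} (hM0 : ∀ N, M N ≠ 0)
    (hM : Tendsto (fun N => (M N : ℂ_[p])) atTop (𝓝 0)) (n : ℕ) (y z : ℂ_[p]) :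
    Tendsto (fun N => (M N : ℂ_[p])⁻¹ * ∑ j ∈ range (M N), (y + z * j) ^ n) atTop
      (𝓝 (bernoulliForm n y z)) := by
  have h := tendsto_finsetSum (range (n + 1)) fun i _ =>
    (tendsto_mean_pow hM0 hM i).const_mul (z ^ i * y ^ (n - i) * (n.choose i : ℂ_[p]))
  refine h.congr fun N => ?_
  have h1 : ∀ j : ℕ, (y + z * j) ^ n = ∑ i ∈ range (n + 1),
      z ^ i * y ^ (n - i) * (n.choose i : ℂ_[p]) * (j : ℂ_[p]) ^ i := fun j => by
    rw [add_comm, add_pow]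
    exact sum_congr rfl fun i _ => by ring
  simp only [h1]
  rw [sum_comm, mul_sum]
  refine sum_congr rfl fun i _ => ?_
  rw [← mul_sum]
  ring

/-- Means of a function that is, on each residue class modulo `m`, the `n`-th power of a linear
function up to a factor. -/
theorem tendsto_mean_of_linear_pow {m n : ℕ} {M : ℕ → ℕ} (hM0 : ∀ N, M N ≠ 0)
    (hM : Tendsto (fun N => (M N : ℂ_[p])) atTop (𝓝 0)) {φ g y z : ℕ → ℂ_[p]}
    (hφ : ∀ a j, φ (a + m * j) = g a * (y a + z a * j) ^ n) :
    Tendsto (fun N => ((m * M N : ℕ) : ℂ_[p])⁻¹ * ∑ t ∈ Icc 1 (m * M N), φ t) atTop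
      (𝓝 ((m : ℂ_[p])⁻¹ * ∑ a ∈ Icc 1 m, g a * bernoulliForm n (y a) (z a))) := by
  have h := (tendsto_finsetSum (Icc 1 m) fun a _ =>
    (tendsto_mean_linear_pow hM0 hM n (y a) (z a)).const_mul (g a)).const_mul (m : ℂ_[p])⁻¹
  refine h.congr fun N => ?_
  rw [sum_Icc_mul, sum_comm, Nat.cast_mul, mul_inv, mul_assoc]
  congr 1
  rw [mul_sum]
  refine sum_congr rfl fun a _ => ?_
  simp only [hφ]
  rw [← mul_sum]
  ring

theorem tendsto_mean_periodic_mul_pow {m : ℕ} {M : ℕ → ℕ} (hM0 : ∀ N, M N ≠ 0)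
    (hM : Tendsto (fun N => (M N : ℂ_[p])) atTop (𝓝 0)) {g : ℕ → ℂ_[p]}
    (hg : ∀ a, g (a + m) = g a) (n : ℕ) :
    Tendsto (fun N => ((m * M N : ℕ) : ℂ_[p])⁻¹ * ∑ t ∈ Icc 1 (m * M N), g t * (t : ℂ_[p]) ^ n)
      atTop (𝓝 ((m : ℂ_[p])⁻¹ * ∑ a ∈ Icc 1 m, g a * bernoulliForm n a m)) := by
  refine tendsto_mean_of_linear_pow (y := fun a => (a : ℂ_[p])) (z := fun _ => (m : ℂ_[p]))
    hM0 hM fun a j => ?_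
  rw [periodic_add_mul hg]
  push_cast
  rfl

theorem bernoulliForm_natCast (n : ℕ) {a m : ℂ_[p]} (hm : m ≠ 0) :
    bernoulliForm n a m = m ^ n * Polynomial.aeval (a / m) (Polynomial.bernoulli n) := by
  rw [Polynomial.bernoulli, map_sum, bernoulliForm, mul_sum]
  refine sum_congr rfl fun i hi => ?_
  have hi' : m ^ n = m ^ i * m ^ (n - i) := by
    rw [← pow_add, Nat.add_sub_cancel' (Nat.lt_succ_iff.mp (mem_range.mp hi))]
  rw [Polynomial.aeval_monomial, map_mul, map_natCast, div_pow, eq_ratCast, hi']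
  field_simp

/-- The generalized Bernoulli number `B_{n,ψ}` is a `p`-adic limit of means of `ψ(t) t ^ n`. The
lengths `m * M N` are arbitrary multiples of `m` that tend to `0`, which allows to compare
different periods of `ψ`. -/
theorem tendsto_mean_genBernoulli {m : ℕ} [NeZero m] (ψ : DirichletCharacter ℂ_[p] m)
    {M : ℕ → ℕ} (hM0 : ∀ N, M N ≠ 0) (hM : Tendsto (fun N => (M N : ℂ_[p])) atTop (𝓝 0)) (n : ℕ) :
    Tendsto (fun N => ((m * M N : ℕ) : ℂ_[p])⁻¹ *
      ∑ t ∈ Icc 1 (m * M N), ψ (t : ZMod m) * (t : ℂ_[p]) ^ n) atTop (𝓝 (genBernoulli ψ n)) := by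
  have hm : (m : ℂ_[p]) ≠ 0 := by exact_mod_cast NeZero.ne m
  have h := tendsto_mean_periodic_mul_pow hM0 hM (g := fun t => ψ (t : ZMod m)) (m := m)
    (fun a => by simp) n
  convert h using 2
  rw [genBernoulli, zpow_sub_one₀ hm, zpow_natCast, mul_comm (_ ^ n), mul_assoc, mul_sum]
  congr 1
  refine sum_congr rfl fun a _ => ?_
  rw [bernoulliForm_natCast n hm]
  ring

theorem norm_bernoulliForm_le {y z : ℂ_[p]} {r : ℝ} (hy : ‖y‖ ≤ r) (hz : ‖z‖ ≤ r) (n : ℕ) :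
    ‖bernoulliForm n y z‖ ≤ r ^ n * p := by
  have hr : 0 ≤ r := (norm_nonneg y).trans hy
  refine IsUltrametricDist.norm_sum_le_of_forall_le_of_nonneg
    (mul_nonneg (pow_nonneg hr n) p_pos.le) fun i hi => ?_
  have hi' : n = i + (n - i) := by
    have := mem_range.mp hi
    omega
  rw [norm_mul, norm_mul, norm_mul, norm_pow, norm_pow]
  refine mul_le_mul ?_ (norm_bernoulli_le i) (norm_nonneg _) (pow_nonneg hr n)
  calc ‖z‖ ^ i * ‖y‖ ^ (n - i) * ‖(n.choose i : ℂ_[p])‖ ≤ r ^ i * r ^ (n - i) * 1 := by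
        gcongr
        exact norm_natCast_le_one _
    _ = r ^ n := by rw [mul_one, ← pow_add, ← hi']

end BernoulliLimits

/-! ### The characters `χ ω⁻ⁿ` and their moments -/

section Characters

theorem coprime_q_iff {a : ℕ} : a.Coprime (q p) ↔ ¬ p ∣ a := by
  refine ⟨fun h hpa => ?_, fun h => ?_⟩
  · have h1 := Nat.dvd_gcd hpa (p_dvd_q p)
    rw [h, Nat.dvd_one] at h1
    exact hp.out.one_lt.ne' h1
  · exact Nat.Coprime.of_dvd_right (q_dvd_sq p)
      (((Nat.Prime.coprime_iff_not_dvd hp.out).mpr h).symm.pow_right 2)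

theorem isUnit_natCast_q {a : ℕ} (ha : ¬ p ∣ a) : IsUnit (a : ZMod (q p)) :=
  (ZMod.isUnit_iff_coprime a (q p)).mpr (coprime_q_iff.mpr ha)

theorem norm_omega {a : ℕ} (ha : ¬ p ∣ a) : ‖omega p (a : ZMod (q p))‖ = 1 := by
  rw [← (isUnit_natCast_q ha).unit_spec]
  exact DirichletCharacter.unit_norm_eq_one _ _

theorem omega_ne_zero {a : ℕ} (ha : ¬ p ∣ a) : omega p (a : ZMod (q p)) ≠ 0 :=
  norm_ne_zero_iff.mp (by rw [norm_omega ha]; exact one_ne_zero)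

theorem norm_angle_sub_one_le {a : ℕ} (ha : ¬ p ∣ a) : ‖angle p a - 1‖ ≤ (q p : ℝ)⁻¹ := by
  have h : angle p a - 1 =
      -((omega p (a : ZMod (q p)))⁻¹ * (omega p (a : ZMod (q p)) - (a : ℂ_[p]))) := by
    rw [angle, mul_sub, inv_mul_cancel₀ (omega_ne_zero ha)]
    ring
  rw [h, norm_neg, norm_mul, norm_inv, norm_omega ha, inv_one, one_mul]
  exact norm_omega_sub_le a ha

theorem omega_inv_pow_apply {a : ℕ} (ha : ¬ p ∣ a) (n : ℕ) :
    ((omega p)⁻¹ ^ n) (a : ZMod (q p)) = (omega p (a : ZMod (q p)))⁻¹ ^ n := by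
  rw [← (isUnit_natCast_q ha).unit_spec, MulChar.pow_apply_coe, MulChar.inv_apply_eq_inv']

variable {f : ℕ}

/-- The function `a ↦ χ(a) ω(a)⁻ⁿ` on natural numbers prime to `p`, extended by zero. -/
noncomputable def twistFun (χ : DirichletCharacter ℂ_[p] f) (n a : ℕ) : ℂ_[p] :=
  if p ∣ a then 0 else χ (a : ZMod f) * (omega p (a : ZMod (q p)))⁻¹ ^ n

theorem twistFun_of_not_dvd (χ : DirichletCharacter ℂ_[p] f) (n : ℕ) {a : ℕ} (ha : ¬ p ∣ a) :
    twistFun χ n a = χ (a : ZMod f) * (omega p (a : ZMod (q p)))⁻¹ ^ n := if_neg ha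

theorem twistFun_of_dvd (χ : DirichletCharacter ℂ_[p] f) (n : ℕ) {a : ℕ} (ha : p ∣ a) :
    twistFun χ n a = 0 := if_pos ha

theorem norm_twistFun_le (χ : DirichletCharacter ℂ_[p] f) (n a : ℕ) : ‖twistFun χ n a‖ ≤ 1 := by
  by_cases ha : p ∣ a
  · rw [twistFun_of_dvd χ n ha, norm_zero]
    exact zero_le_one
  · rw [twistFun_of_not_dvd χ n ha, norm_mul, norm_pow, norm_inv, norm_omega ha, inv_one, one_pow,
      mul_one]
    exact DirichletCharacter.norm_le_one χ _

theorem dvd_add_mul_iff {F : ℕ} (hqF : q p ∣ F) (a j : ℕ) : p ∣ a + F * j ↔ p ∣ a :=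
  (Nat.dvd_add_left (Dvd.dvd.mul_right ((p_dvd_q p).trans hqF) j))

theorem natCast_add_mul {m F : ℕ} (hmF : m ∣ F) (a j : ℕ) :
    ((a + F * j : ℕ) : ZMod m) = (a : ZMod m) := by
  have := (ZMod.natCast_eq_zero_iff F m).mpr hmF
  push_cast
  rw [this, zero_mul, add_zero]

theorem twistFun_add_mul (χ : DirichletCharacter ℂ_[p] f) (n : ℕ) {F : ℕ} (hqF : q p ∣ F)
    (hfF : f ∣ F) (a j : ℕ) : twistFun χ n (a + F * j) = twistFun χ n a := by
  simp only [twistFun, dvd_add_mul_iff hqF, natCast_add_mul hqF, natCast_add_mul hfF]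

theorem twistFun_add (χ : DirichletCharacter ℂ_[p] f) (n : ℕ) {F : ℕ} (hqF : q p ∣ F)
    (hfF : f ∣ F) (a : ℕ) : twistFun χ n (a + F) = twistFun χ n a := by
  simpa using twistFun_add_mul χ n hqF hfF a 1

theorem twistFun_mul (χ : DirichletCharacter ℂ_[p] f) (n a b : ℕ) :
    twistFun χ n (a * b) = twistFun χ n a * twistFun χ n b := by
  by_cases ha : p ∣ a
  · rw [twistFun_of_dvd χ n ha, twistFun_of_dvd χ n (ha.mul_right b), zero_mul]
  by_cases hb : p ∣ b
  · rw [twistFun_of_dvd χ n hb, twistFun_of_dvd χ n (hb.mul_left a), mul_zero]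
  have hab : ¬ p ∣ a * b := fun h => (hp.out.dvd_mul.mp h).elim ha hb
  rw [twistFun_of_not_dvd χ n ha, twistFun_of_not_dvd χ n hb, twistFun_of_not_dvd χ n hab]
  push_cast
  rw [map_mul, map_mul, mul_inv, mul_pow]
  ring

theorem twistFun_mul_angle_pow (χ : DirichletCharacter ℂ_[p] f) (n k a : ℕ) :
    twistFun χ n a * angle p a ^ k = twistFun χ (n + k) a * (a : ℂ_[p]) ^ k := by
  by_cases ha : p ∣ a
  · rw [twistFun_of_dvd χ n ha, twistFun_of_dvd χ _ ha, zero_mul, zero_mul]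
  rw [twistFun_of_not_dvd χ n ha, twistFun_of_not_dvd χ _ ha, angle, mul_pow, pow_add]
  ring

theorem dvd_lcm_conductor_mul [NeZero f] {χ : DirichletCharacter ℂ_[p] f} (hχ : χ.IsPrimitive)
    {d : ℕ} [NeZero d] (η : DirichletCharacter ℂ_[p] d) :
    f ∣ Nat.lcm (χ.mul η).conductor d := by
  have hL : Nat.lcm f d ≠ 0 := Nat.lcm_ne_zero (NeZero.ne f) (NeZero.ne d)
  have : NeZero (Nat.lcm f d) := ⟨hL⟩
  have hfL := Nat.dvd_lcm_left f d
  have hdL := Nat.dvd_lcm_right f d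
  have hD : Nat.lcm (χ.mul η).conductor d ∣ Nat.lcm f d :=
    Nat.lcm_dvd (DirichletCharacter.conductor_dvd_level _) hdL
  -- `χ = (χ η) η⁻¹` at level `lcm f d`, and both factors come from level `lcm (cond (χ η)) d`
  suffices h : (DirichletCharacter.changeLevel hfL χ).conductor ∣
      Nat.lcm (χ.mul η).conductor d by
    rwa [DirichletCharacter.conductor_changeLevel,
      (DirichletCharacter.isPrimitive_def χ).mp hχ] at h
  rw [← DirichletCharacter.mem_conductorSet_iff_conductor_dvd _ hD]
  refine ⟨hD, DirichletCharacter.changeLevel (Nat.dvd_lcm_left _ _)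
    (χ.mul η).primitiveCharacter * DirichletCharacter.changeLevel (Nat.dvd_lcm_right _ _) η⁻¹, ?_⟩
  rw [map_mul, ← DirichletCharacter.changeLevel_trans, ← DirichletCharacter.changeLevel_trans,
    DirichletCharacter.changeLevel_primitiveCharacter, map_inv]
  exact (mul_inv_cancel_right _ _).symm

instance neZero_q : NeZero (q p) := ⟨by have := three_le_q p; omega⟩

/-- Away from `p` the primitive character attached to `χ ω⁻ⁿ` takes the values `χ(a) ω(a)⁻ⁿ`, also
at integers that are not prime to `f`, since `χ` is primitive and the conductor of `ω` is a power
of `p`. -/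
theorem twist_apply [NeZero f] {χ : DirichletCharacter ℂ_[p] f} (hχ : χ.IsPrimitive) (n : ℕ)
    {a : ℕ} (ha : ¬ p ∣ a) : twist χ n (a : ZMod _) = twistFun χ n a := by
  rw [twistFun_of_not_dvd χ n ha, ← omega_inv_pow_apply ha]
  have haq : a.Coprime (q p) := coprime_q_iff.mpr ha
  by_cases haf : a.Coprime f
  · have haL : IsCoprime (a : ℤ) (Nat.lcm f (q p) : ℕ) :=
      Nat.isCoprime_iff_coprime.mpr ((haf.mul_right haq).of_dvd_right (Nat.lcm_dvd_mul f (q p)))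
    have h := DirichletCharacter.primitiveCharacter_apply_of_isCoprime
      (χ.mul ((omega p)⁻¹ ^ n)) haL
    have h1 := DirichletCharacter.changeLevel_eq_cast_of_dvd' χ (Nat.dvd_lcm_left f (q p)) haL
    have h2 := DirichletCharacter.changeLevel_eq_cast_of_dvd' ((omega p)⁻¹ ^ n)
      (Nat.dvd_lcm_right f (q p)) haL
    simp only [Int.cast_natCast] at h h1 h2
    rw [← h1, ← h2, ← MulChar.mul_apply]
    exact h
  · have h0 : χ (a : ZMod f) = 0 :=
      MulChar.map_nonunit _ fun h => haf ((ZMod.isUnit_iff_coprime a f).mp h)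
    rw [h0, zero_mul]
    refine MulChar.map_nonunit _ fun h => haf ?_
    have h1 := (ZMod.isUnit_iff_coprime _ _).mp h
    exact ((h1.mul_right haq).of_dvd_right (Nat.lcm_dvd_mul _ _)).of_dvd_right
      (dvd_lcm_conductor_mul hχ _)

theorem sum_filter_dvd_Icc {A : Type*} [AddCommMonoid A] (k : ℕ) (Φ : ℕ → A) :
    ∑ t ∈ (Icc 1 (p * k)).filter (p ∣ ·), Φ t = ∑ t ∈ Icc 1 k, Φ (p * t) := by
  have hp0 := hp.out.pos
  refine (sum_nbij (p * ·) (fun t ht => ?_) (fun a _ b _ h => ?_) (fun t ht => ?_)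
    fun _ _ => rfl).symm
  · rw [mem_Icc] at ht
    rw [mem_filter, mem_Icc]
    exact ⟨⟨Nat.mul_pos hp0 ht.1, Nat.mul_le_mul_left p ht.2⟩, dvd_mul_right p t⟩
  · exact Nat.eq_of_mul_eq_mul_left hp0 h
  · rw [mem_coe, mem_filter, mem_Icc] at ht
    obtain ⟨⟨h1, h2⟩, t, rfl⟩ := ht
    refine ⟨t, ?_, rfl⟩
    rw [mem_coe, mem_Icc]
    exact ⟨Nat.pos_of_mul_pos_left h1, Nat.le_of_mul_le_mul_left h2 hp0⟩

theorem tendsto_mul_p_pow (k : ℕ) :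
    Tendsto (fun N : ℕ => ((k * p ^ N : ℕ) : ℂ_[p])) atTop (𝓝 0) := by
  have : ‖(p : ℂ_[p])‖ < 1 := by
    rw [norm_p]
    exact inv_lt_one_of_one_lt₀ one_lt_p
  simpa using (tendsto_pow_atTop_nhds_zero_of_norm_lt_one this).const_mul (k : ℂ_[p])

theorem mul_p_pow_ne_zero {k : ℕ} (hk : k ≠ 0) (N : ℕ) : k * p ^ N ≠ 0 :=
  mul_ne_zero hk (pow_ne_zero N hp.out.ne_zero)

/-- The means of `χω⁻ⁿ(t) t ^ n` over `t` prime to `p` tend to the generalized Bernoulli number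
without its Euler factor at `p`. -/
theorem tendsto_mean_twistFun [NeZero f] {χ : DirichletCharacter ℂ_[p] f} (hχ : χ.IsPrimitive)
    {F : ℕ} (hF : F ≠ 0) (hqF : q p ∣ F) (hfF : f ∣ F) {n : ℕ} (hn : 1 ≤ n) :
    Tendsto (fun N => ((F * p ^ N : ℕ) : ℂ_[p])⁻¹ *
      ∑ t ∈ Icc 1 (F * p ^ N), twistFun χ n t * (t : ℂ_[p]) ^ n) atTop
      (𝓝 ((1 - twist χ n (p : ZMod _) * (p : ℂ_[p]) ^ (n - 1)) * genBernoulli (twist χ n) n)) := by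
  set m := (χ.mul ((omega p)⁻¹ ^ n)).conductor with hm
  set ψ : DirichletCharacter ℂ_[p] m := twist χ n with hψ
  have hL : NeZero (Nat.lcm f (q p)) := ⟨Nat.lcm_ne_zero (NeZero.ne f) (NeZero.ne (q p))⟩
  have hm0 : NeZero m := ⟨DirichletCharacter.conductor_ne_zero _⟩
  have hmF : m ∣ F := (DirichletCharacter.conductor_dvd_level _).trans (Nat.lcm_dvd hfF hqF)
  have hp0 : (p : ℂ_[p]) ≠ 0 := by exact_mod_cast hp.out.ne_zero
  have hlim : ∀ {K : ℕ}, K ≠ 0 → m ∣ K → Tendsto (fun N => ((K * p ^ N : ℕ) : ℂ_[p])⁻¹ *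
      ∑ t ∈ Icc 1 (K * p ^ N), ψ (t : ZMod m) * (t : ℂ_[p]) ^ n) atTop
      (𝓝 (genBernoulli ψ n)) := by
    rintro K hK ⟨k, rfl⟩
    have hk : k ≠ 0 := right_ne_zero_of_mul hK
    simpa only [mul_assoc] using
      tendsto_mean_genBernoulli ψ (mul_p_pow_ne_zero (p := p) hk) (tendsto_mul_p_pow k) n
  obtain ⟨F', rfl⟩ := (p_dvd_q p).trans hqF
  have hF' : F' ≠ 0 := right_ne_zero_of_mul hF
  -- the part of the mean over `t` divisible by `p`; if `p` divides the conductor `m`, it vanishes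
  -- with `ψ(p)`, and otherwise `m` divides `F' = F / p`
  have hpart : Tendsto (fun N => ((F' * p ^ N : ℕ) : ℂ_[p])⁻¹ *
      ∑ t ∈ Icc 1 (F' * p ^ N), ψ (p : ZMod m) * (ψ (t : ZMod m) * (t : ℂ_[p]) ^ n)) atTop
      (𝓝 (ψ (p : ZMod m) * genBernoulli ψ n)) := by
    simp only [← mul_sum]
    by_cases hpm : p ∣ m
    · have h0 : ψ (p : ZMod m) = 0 := MulChar.map_nonunit _ fun h => by
        have h1 := (ZMod.isUnit_iff_coprime _ _).mp h
        exact (Nat.Prime.coprime_iff_not_dvd hp.out).mp h1 hpm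
      simp [h0]
    · have hmF' : m ∣ F' :=
        (((Nat.Prime.coprime_iff_not_dvd hp.out).mpr hpm).symm).dvd_of_dvd_mul_left hmF
      refine ((hlim hF' hmF').const_mul (ψ (p : ZMod m))).congr fun N => ?_
      ring
  have h := (hlim hF hmF).sub (hpart.const_mul ((p : ℂ_[p]) ^ (n - 1)))
  have hval : genBernoulli ψ n - (p : ℂ_[p]) ^ (n - 1) * (ψ (p : ZMod m) * genBernoulli ψ n) =
      (1 - ψ (p : ZMod m) * (p : ℂ_[p]) ^ (n - 1)) * genBernoulli ψ n := by ring
  rw [hval] at h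
  refine h.congr fun N => ?_
  have h1 : ∑ t ∈ Icc 1 (p * F' * p ^ N), twistFun χ n t * (t : ℂ_[p]) ^ n =
      ∑ t ∈ Icc 1 (p * F' * p ^ N), ψ (t : ZMod m) * (t : ℂ_[p]) ^ n -
        ∑ t ∈ (Icc 1 (p * F' * p ^ N)).filter (p ∣ ·), ψ (t : ZMod m) * (t : ℂ_[p]) ^ n := by
    rw [sum_filter, ← sum_sub_distrib]
    refine sum_congr rfl fun t _ => ?_
    split_ifs with ht
    · rw [twistFun_of_dvd χ n ht, zero_mul, sub_self]
    · rw [← twist_apply hχ n ht, sub_zero]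
  have h2 : ∑ t ∈ (Icc 1 (p * F' * p ^ N)).filter (p ∣ ·), ψ (t : ZMod m) * (t : ℂ_[p]) ^ n =
      (p : ℂ_[p]) ^ n *
        ∑ t ∈ Icc 1 (F' * p ^ N), ψ (p : ZMod m) * (ψ (t : ZMod m) * (t : ℂ_[p]) ^ n) := by
    rw [mul_assoc, sum_filter_dvd_Icc, mul_sum]
    refine sum_congr rfl fun t _ => ?_
    push_cast
    rw [map_mul]
    ring
  rw [h1, h2, mul_sub]
  congr 1
  have h3 : (p : ℂ_[p]) ^ n = p ^ (n - 1) * p := by rw [← pow_succ, Nat.sub_add_cancel hn]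
  rw [h3]
  push_cast
  field_simp

end Characters

/-! ### Existence of the `p`-adic `L`-function -/

section Existence

theorem neg_p_pow_eq (k : ℕ) : -(p : ℂ_[p]) ^ k = 1 - ((p ^ k + 1 : ℕ) : ℂ_[p]) := by
  push_cast
  ring

theorem neg_p_pow_ne_one (k : ℕ) : -(p : ℂ_[p]) ^ k ≠ 1 := by
  have h : ((p ^ k + 1 : ℕ) : ℂ_[p]) ≠ 0 := Nat.cast_ne_zero.mpr (Nat.succ_ne_zero _)
  rw [neg_p_pow_eq]
  exact fun h1 => h (by linear_combination -h1)

theorem newton_natCast (m : ℕ) (x : ℕ → ℂ_[p]) :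
    ∑' n, binom p (m : ℂ_[p]) n * x n = ∑ n ∈ range (m + 1), (m.choose n : ℂ_[p]) * x n := by
  simp only [binom_natCast]
  refine tsum_eq_sum fun n hn => ?_
  rw [Nat.choose_eq_zero_of_lt (by simpa using hn), Nat.cast_zero, zero_mul]

theorem sum_choose_mul_sub_one_pow (m : ℕ) (y : ℂ_[p]) :
    ∑ n ∈ range (m + 1), (m.choose n : ℂ_[p]) * (y - 1) ^ n = y ^ m := by
  conv_rhs => rw [← sub_add_cancel y 1, add_pow]
  exact sum_congr rfl fun n _ => by rw [one_pow]; ring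

theorem anglePow_natCast (a m : ℕ) : anglePow p a (m : ℂ_[p]) = angle p a ^ m := by
  rw [anglePow, newton_natCast, sum_choose_mul_sub_one_pow]

theorem newtonBound_of_norm_le {x : ℕ → ℂ_[p]} {C : ℝ} (hC : 0 ≤ C)
    (hx : ∀ n, ‖x n‖ ≤ C * (q p : ℝ)⁻¹ ^ n) : NewtonBound x := by
  refine ⟨C, hC, fun n => (hx n).trans ?_⟩
  have : (0 : ℝ) ≤ (q p : ℝ)⁻¹ ^ n := by positivity
  gcongr
  exact le_mul_of_one_le_right hC (by simp)

theorem newtonBound_angle {a : ℕ} (ha : ¬ p ∣ a) : NewtonBound fun n => (angle p a - 1) ^ n :=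
  newtonBound_of_norm_le zero_le_one fun n => by
    rw [norm_pow, one_mul]
    exact pow_le_pow_left₀ (norm_nonneg _) (norm_angle_sub_one_le ha) n

theorem binom_succ (s : ℂ_[p]) (n : ℕ) :
    binom p (1 - s) (n + 1) = (1 - s) * (binom p (-s) n / (n + 1)) := by
  have h1 : ((n.factorial : ℕ) : ℂ_[p]) ≠ 0 := by exact_mod_cast n.factorial_ne_zero
  have h2 : (n : ℂ_[p]) + 1 ≠ 0 := by exact_mod_cast n.succ_ne_zero
  have h3 : ∀ i : ℕ, 1 - s - ((i + 1 : ℕ) : ℂ_[p]) = -s - i := fun i => by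
    push_cast
    ring
  rw [binom, binom, prod_range_succ', Nat.factorial_succ]
  simp only [h3]
  push_cast
  field_simp
  ring

theorem norm_natCast_le_q_inv {F : ℕ} (hqF : q p ∣ F) : ‖(F : ℂ_[p])‖ ≤ (q p : ℝ)⁻¹ := by
  rw [← norm_q]
  exact norm_natCast_le_of_dvd hqF

variable {f : ℕ}

theorem angle_add_mul {F : ℕ} (hqF : q p ∣ F) (a j : ℕ) :
    angle p (a + F * j) =
      angle p a + (omega p (a : ZMod (q p)))⁻¹ * (F : ℂ_[p]) * (j : ℂ_[p]) := by
  rw [angle, angle, natCast_add_mul hqF]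
  push_cast
  ring

/-- The `p`-adic mean of `χ(t) (⟨t⟩ - 1) ^ n` over `t` prime to `p`, in closed form. -/
noncomputable def meanMoment (χ : DirichletCharacter ℂ_[p] f) (F n : ℕ) : ℂ_[p] :=
  (F : ℂ_[p])⁻¹ * ∑ a ∈ Icc 1 F, twistFun χ 0 a *
    bernoulliForm n (angle p a - 1) ((omega p (a : ZMod (q p)))⁻¹ * (F : ℂ_[p]))

theorem tendsto_meanMoment (χ : DirichletCharacter ℂ_[p] f) {F : ℕ} (hqF : q p ∣ F)
    (hfF : f ∣ F) (n : ℕ) :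
    Tendsto (fun N => ((F * p ^ N : ℕ) : ℂ_[p])⁻¹ *
      ∑ t ∈ Icc 1 (F * p ^ N), twistFun χ 0 t * (angle p t - 1) ^ n) atTop
      (𝓝 (meanMoment χ F n)) := by
  refine tendsto_mean_of_linear_pow (M := fun N => p ^ N)
    (g := twistFun χ 0) (y := fun a => angle p a - 1)
    (z := fun a => (omega p (a : ZMod (q p)))⁻¹ * (F : ℂ_[p]))
    (fun N => pow_ne_zero N hp.out.ne_zero) ?_ fun a j => ?_
  · simpa using tendsto_mul_p_pow (p := p) 1
  · rw [twistFun_add_mul χ 0 hqF hfF, angle_add_mul hqF]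
    ring

theorem norm_meanMoment_le (χ : DirichletCharacter ℂ_[p] f) {F : ℕ} (hqF : q p ∣ F) (n : ℕ) :
    ‖meanMoment χ F n‖ ≤ ‖(F : ℂ_[p])‖⁻¹ * p * (q p : ℝ)⁻¹ ^ n := by
  have hp0 := p_pos (p := p)
  rw [meanMoment, norm_mul, norm_inv, mul_assoc]
  refine mul_le_mul_of_nonneg_left ?_ (by positivity)
  refine IsUltrametricDist.norm_sum_le_of_forall_le_of_nonneg (by positivity) fun a _ => ?_
  by_cases ha : p ∣ a
  · rw [twistFun_of_dvd χ 0 ha, zero_mul, norm_zero]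
    positivity
  rw [norm_mul, mul_comm (p : ℝ)]
  have hz : ‖(omega p (a : ZMod (q p)))⁻¹ * (F : ℂ_[p])‖ ≤ (q p : ℝ)⁻¹ := by
    rw [norm_mul, norm_inv, norm_omega ha, inv_one, one_mul]
    exact norm_natCast_le_q_inv hqF
  exact (mul_le_of_le_one_left (norm_nonneg _) (norm_twistFun_le χ 0 a)).trans
    (norm_bernoulliForm_le (norm_angle_sub_one_le ha) hz n)

theorem newtonBound_meanMoment (χ : DirichletCharacter ℂ_[p] f) {F : ℕ} (hqF : q p ∣ F) :
    NewtonBound (meanMoment χ F) :=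
  newtonBound_of_norm_le (mul_nonneg (by positivity) p_pos.le) (norm_meanMoment_le χ hqF)

/-- The total mean of a nontrivial character vanishes; this is what cancels the pole at `s = 1`. -/
theorem meanMoment_zero [NeZero f] {χ : DirichletCharacter ℂ_[p] f} (hχ : χ ≠ 1) {F : ℕ}
    (hF : F ≠ 0) (hqF : q p ∣ F) (hfF : f ∣ F) : meanMoment χ F 0 = 0 := by
  have : NeZero F := ⟨hF⟩
  obtain ⟨u, hu⟩ := MulChar.ne_one_iff.mp
    (mt (DirichletCharacter.changeLevel_eq_one_iff hfF).mp hχ)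
  -- multiplying the sum by `χ(b) ≠ 1` permutes its terms
  set b : ℕ := (u : ZMod F).val with hb
  have hbF : b.Coprime F := ZMod.val_coe_unit_coprime u
  have hpb : ¬ p ∣ b := fun h => by
    have h1 := Nat.dvd_gcd h ((p_dvd_q p).trans hqF)
    rw [hbF, Nat.dvd_one] at h1
    exact hp.out.one_lt.ne' h1
  have hb0 : 0 < b := Nat.pos_of_ne_zero fun h => hpb (h ▸ dvd_zero p)
  have hχb : twistFun χ 0 b ≠ 1 := by
    rw [twistFun_of_not_dvd χ 0 hpb, pow_zero, mul_one]
    rwa [DirichletCharacter.changeLevel_eq_cast_of_dvd, ← ZMod.natCast_val] at hu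
  have hsum := sum_periodic_comp_mul hb0 hbF (twistFun_add χ 0 hqF hfF)
  simp only [twistFun_mul, ← mul_sum] at hsum
  have h0 : ∑ t ∈ Icc 1 F, twistFun χ 0 t = 0 := by
    have h1 : (twistFun χ 0 b - 1) * ∑ t ∈ Icc 1 F, twistFun χ 0 t = 0 := by
      rw [sub_mul, hsum, one_mul, sub_self]
    exact (mul_eq_zero.mp h1).resolve_left (sub_ne_zero.mpr hχb)
  simp [meanMoment, bernoulliForm, h0]

/-- The function `(s - 1) L_p(s, χ)`, as the `p`-adic mean of `χ(t) ⟨t⟩ ^ (1 - s)` over `t` prime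
to `p`, expanded as a Newton series. -/
noncomputable def poleFun (χ : DirichletCharacter ℂ_[p] f) (F : ℕ) (s : ℂ_[p]) : ℂ_[p] :=
  ∑' n, binom p (1 - s) n * meanMoment χ F n

theorem analyticOnDisc_poleFun (χ : DirichletCharacter ℂ_[p] f) {F : ℕ} (hqF : q p ∣ F) :
    AnalyticOnDisc (poleFun χ F) :=
  (newtonBound_meanMoment χ hqF).analyticOnDisc norm_one.le

theorem poleFun_one_sub [NeZero f] {χ : DirichletCharacter ℂ_[p] f} (hχ : χ.IsPrimitive)
    {F : ℕ} (hF : F ≠ 0) (hqF : q p ∣ F) (hfF : f ∣ F) {m : ℕ} (hm : 1 ≤ m) :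
    poleFun χ F (1 - (m : ℂ_[p])) =
      (1 - twist χ m (p : ZMod _) * (p : ℂ_[p]) ^ (m - 1)) * genBernoulli (twist χ m) m := by
  rw [poleFun, sub_sub_cancel, newton_natCast]
  refine tendsto_nhds_unique (tendsto_finsetSum (range (m + 1)) fun n _ =>
    (tendsto_meanMoment χ hqF hfF n).const_mul (m.choose n : ℂ_[p]))
    ((tendsto_mean_twistFun hχ hF hqF hfF hm).congr fun N => ?_)
  have h : ∀ t : ℕ, twistFun χ m t * (t : ℂ_[p]) ^ m =
      ∑ n ∈ range (m + 1), (m.choose n : ℂ_[p]) * (twistFun χ 0 t * (angle p t - 1) ^ n) := by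
    intro t
    have h1 := twistFun_mul_angle_pow χ 0 m t
    rw [zero_add] at h1
    rw [← h1, ← sum_choose_mul_sub_one_pow, mul_sum]
    exact sum_congr rfl fun n _ => by ring
  simp only [h]
  rw [sum_comm, mul_sum]
  refine sum_congr rfl fun n _ => ?_
  rw [← mul_sum]
  ring

/-- The quotient of `poleFun χ F s` by `s - 1` for `χ ≠ 1`, obtained by dividing each binomial
coefficient of the Newton series by `1 - s`. -/
theorem exists_analyticOnDisc_sub_one_mul [NeZero f] {χ : DirichletCharacter ℂ_[p] f}
    (hχ : χ ≠ 1) {F : ℕ} (hF : F ≠ 0) (hqF : q p ∣ F) (hfF : f ∣ F) :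
    ∃ L : ℂ_[p] → ℂ_[p], AnalyticOnDisc L ∧
      ∀ s, ‖s‖ < radius p → (s - 1) * L s = poleFun χ F s := by
  set x : ℕ → ℂ_[p] := fun n => -(meanMoment χ F (n + 1) / ((n : ℂ_[p]) + 1)) with hx
  have hxb : NewtonBound x := by
    have hp0 := p_pos (p := p)
    have hq0 := q_pos p
    refine ⟨‖(F : ℂ_[p])‖⁻¹ * p * (q p : ℝ)⁻¹, by positivity, fun n => ?_⟩
    have h1 := inv_norm_natCast_le (p := p) n.succ_ne_zero
    push_cast at h1
    rw [hx, norm_neg, norm_div, div_eq_mul_inv]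
    calc _ ≤ (‖(F : ℂ_[p])‖⁻¹ * p * (q p : ℝ)⁻¹ ^ (n + 1)) * ((n : ℝ) + 1) := by
          gcongr
          exact norm_meanMoment_le χ hqF (n + 1)
      _ = _ := by ring
  refine ⟨fun s => ∑' n, binom p (0 - s) n * x n, hxb.analyticOnDisc (by simp), fun s hs => ?_⟩
  have hs1 : ‖1 - s‖ < radius p :=
    (norm_sub_le_max _ _).trans_lt (max_lt (by rw [norm_one]; exact one_lt_radius) hs)
  rw [poleFun, ((newtonBound_meanMoment χ hqF).summable hs1).tsum_eq_zero_add,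
    meanMoment_zero hχ hF hqF hfF, mul_zero, zero_add, ← tsum_mul_left]
  refine tsum_congr fun n => ?_
  rw [binom_succ, zero_sub, hx]
  ring

/-- A function `L` with `(s - 1) L(s) = poleFun χ F s` has the characterizing properties of
`L_p(s, χ)`. -/
theorem isPadicLFunction_of_sub_one_mul [NeZero f] {χ : DirichletCharacter ℂ_[p] f}
    (hprim : χ.IsPrimitive) {F : ℕ} (hF : F ≠ 0) (hqF : q p ∣ F) (hfF : f ∣ F)
    {L : ℂ_[p] → ℂ_[p]} (hL : χ ≠ 1 → AnalyticOnDisc L)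
    (hmul : ∀ s, ‖s‖ < radius p → s ≠ 1 → (s - 1) * L s = poleFun χ F s) :
    IsPadicLFunction χ L where
  analytic h := (hL h).isPowerSeriesOn _
  meromorphic _ := by
    obtain ⟨b, hb⟩ := (analyticOnDisc_poleFun χ hqF).isPowerSeriesOn fun s => s ≠ 1
    refine ⟨b, fun s hs => ?_⟩
    obtain ⟨t, ht, hst⟩ := hb s hs
    exact ⟨t, ht, fun h => (hmul s hs h).trans (hst h)⟩
  interpolation n hn := by
    have hn0 : (n : ℂ_[p]) ≠ 0 := by exact_mod_cast (by omega : n ≠ 0)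
    have hs : ‖1 - (n : ℂ_[p])‖ < radius p :=
      (norm_sub_le_max _ _).trans_lt ((max_le norm_one.le (norm_natCast_le_one n)).trans_lt
        one_lt_radius)
    have h := hmul _ hs (fun h => hn0 (by linear_combination -h))
    rw [poleFun_one_sub hprim hF hqF hfF hn] at h
    field_simp
    linear_combination -h

/-- The `p`-adic `L`-function exists, so that the choice in `padicL` is not the default value `0`. -/
theorem isPadicLFunction_padicL [NeZero f] {χ : DirichletCharacter ℂ_[p] f}
    (hprim : χ.IsPrimitive) : IsPadicLFunction χ (padicL χ) := by
  have hF : q p * f ≠ 0 := mul_ne_zero (NeZero.ne _) (NeZero.ne _)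
  have hqF : q p ∣ q p * f := dvd_mul_right _ _
  have hfF : f ∣ q p * f := dvd_mul_left _ _
  have hex : ∃ L : ℂ_[p] → ℂ_[p], IsPadicLFunction χ L := by
    by_cases hχ : χ = 1
    · refine ⟨fun s => poleFun χ (q p * f) s / (s - 1),
        isPadicLFunction_of_sub_one_mul hprim hF hqF hfF (fun h => absurd hχ h) fun s _ h => ?_⟩
      exact mul_div_cancel₀ _ (sub_ne_zero.mpr h)
    · obtain ⟨L, hL, hmul⟩ := exists_analyticOnDisc_sub_one_mul hχ hF hqF hfF
      exact ⟨L, isPadicLFunction_of_sub_one_mul hprim hF hqF hfF (fun _ => hL)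
        fun s hs _ => hmul s hs⟩
  rw [padicL, dif_pos hex]
  exact hex.choose_spec

theorem analyticOnDisc_padicL [NeZero f] {χ : DirichletCharacter ℂ_[p] f}
    (hprim : χ.IsPrimitive) (hχ : χ ≠ 1) : AnalyticOnDisc (padicL χ) := by
  have hF : q p * f ≠ 0 := mul_ne_zero (NeZero.ne _) (NeZero.ne _)
  have hqF : q p ∣ q p * f := dvd_mul_right _ _
  have hfF : f ∣ q p * f := dvd_mul_left _ _
  obtain ⟨L, hL, hmul⟩ := exists_analyticOnDisc_sub_one_mul hχ hF hqF hfF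
  have hLp := isPadicLFunction_of_sub_one_mul hprim hF hqF hfF (fun _ => hL)
    fun s hs _ => hmul s hs
  have hpL := isPadicLFunction_padicL hprim
  have heq : ∀ s, ‖s‖ < radius p → padicL χ s = L s := fun s hs =>
    (hpL.analytic hχ).eqOn hL (fun _ => trivial) (fun k => by
      rw [neg_p_pow_eq, hpL.interpolation _ (Nat.le_add_left 1 _),
        hLp.interpolation _ (Nat.le_add_left 1 _)]) hs trivial
  obtain ⟨b, hb, hb'⟩ := hL
  exact ⟨b, hb, fun s hs => heq s hs ▸ hb' s hs⟩

theorem sub_one_mul_padicL [NeZero f] {χ : DirichletCharacter ℂ_[p] f}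
    (hprim : χ.IsPrimitive) (hχ : χ = 1) {F : ℕ} (hF : F ≠ 0) (hqF : q p ∣ F) (hfF : f ∣ F)
    {s : ℂ_[p]} (hs : ‖s‖ < radius p) (hs1 : s ≠ 1) : (s - 1) * padicL χ s = poleFun χ F s := by
  have hpL := isPadicLFunction_padicL hprim
  refine (hpL.meromorphic hχ).eqOn (analyticOnDisc_poleFun χ hqF) neg_p_pow_ne_one
    (fun k => ?_) hs hs1
  have hn : ((p ^ k + 1 : ℕ) : ℂ_[p]) ≠ 0 := Nat.cast_ne_zero.mpr (Nat.succ_ne_zero _)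
  rw [neg_p_pow_eq, poleFun_one_sub hprim hF hqF hfF (Nat.le_add_left 1 _),
    hpL.interpolation _ (Nat.le_add_left 1 _)]
  field_simp
  ring

end Existence

/-! ### The regularized function as an integral against `ε` -/

section Regularized

variable {f : ℕ}

/-- The function `χω⁻¹(a) (⟨a⟩ - 1) ^ n` whose integrals against `ε` are the coefficients of the
Newton series of the regularized `p`-adic `L`-function. -/
noncomputable def angleFun (χ : DirichletCharacter ℂ_[p] f) (n a : ℕ) : ℂ_[p] :=
  twistFun χ 1 a * (angle p a - 1) ^ n

theorem norm_angleFun_le (χ : DirichletCharacter ℂ_[p] f) (n a : ℕ) :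
    ‖angleFun χ n a‖ ≤ (q p : ℝ)⁻¹ ^ n := by
  by_cases ha : p ∣ a
  · rw [angleFun, twistFun_of_dvd χ 1 ha, zero_mul, norm_zero]
    positivity
  rw [angleFun, norm_mul, norm_pow]
  exact (mul_le_of_le_one_left (by positivity) (norm_twistFun_le χ 1 a)).trans
    (pow_le_pow_left₀ (norm_nonneg _) (norm_angle_sub_one_le ha) n)

theorem norm_pow_sub_pow_le {x y : ℂ_[p]} {r : ℝ} (hr : 0 < r) (hx : ‖x‖ ≤ r) (hy : ‖y‖ ≤ r)
    (n : ℕ) : ‖x ^ n - y ^ n‖ ≤ r⁻¹ * r ^ n * ‖x - y‖ := by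
  rw [← geom_sum₂_mul, norm_mul]
  refine mul_le_mul_of_nonneg_right ?_ (norm_nonneg _)
  refine IsUltrametricDist.norm_sum_le_of_forall_le_of_nonneg (by positivity) fun i hi => ?_
  have hn : n = i + (n - 1 - i) + 1 := by
    have := mem_range.mp hi
    omega
  calc ‖x ^ i * y ^ (n - 1 - i)‖ ≤ r ^ i * r ^ (n - 1 - i) := by
        rw [norm_mul, norm_pow, norm_pow]
        gcongr
    _ = r⁻¹ * r ^ n := by
        conv_rhs => rw [hn, pow_succ, pow_add]
        field_simp

theorem norm_angleFun_add_mul_sub_le (χ : DirichletCharacter ℂ_[p] f) {F : ℕ} (hqF : q p ∣ F)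
    (hfF : f ∣ F) (n a j : ℕ) : ‖angleFun χ n (a + F * j) - angleFun χ n a‖ ≤
      q p * (q p : ℝ)⁻¹ ^ n * ‖(F : ℂ_[p])‖ := by
  have hq := q_pos p
  by_cases ha : p ∣ a
  · rw [angleFun, angleFun, twistFun_add_mul χ 1 hqF hfF, twistFun_of_dvd χ 1 ha, zero_mul,
      zero_mul, sub_zero, norm_zero]
    positivity
  have ha' : ¬ p ∣ a + F * j := by rwa [dvd_add_mul_iff hqF]
  rw [angleFun, angleFun, twistFun_add_mul χ 1 hqF hfF, ← mul_sub, norm_mul]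
  refine (mul_le_of_le_one_left (norm_nonneg _) (norm_twistFun_le χ 1 a)).trans ?_
  refine (norm_pow_sub_pow_le (inv_pos.mpr hq) (norm_angle_sub_one_le ha')
    (norm_angle_sub_one_le ha) n).trans ?_
  rw [inv_inv, sub_sub_sub_cancel_right, angle_add_mul hqF, add_sub_cancel_left, norm_mul,
    norm_mul, norm_inv, norm_omega ha, inv_one, one_mul]
  gcongr
  exact mul_le_of_le_one_right (norm_nonneg _) (norm_natCast_le_one j)

theorem coprime_p {c F : ℕ} (hqF : q p ∣ F) (hcF : c.Coprime F) : c.Coprime p :=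
  hcF.of_dvd_right ((p_dvd_q p).trans hqF)

theorem not_dvd_of_coprime {c F : ℕ} (hqF : q p ∣ F) (hcF : c.Coprime F) : ¬ p ∣ c :=
  (Nat.Prime.coprime_iff_not_dvd hp.out).mp (coprime_p hqF hcF).symm

theorem norm_epsSum_angleFun_sub_le (χ : DirichletCharacter ℂ_[p] f) {c F : ℕ} (hc : 0 < c)
    (hF : F ≠ 0) (hqF : q p ∣ F) (hfF : f ∣ F) (hcF : c.Coprime F) (n N : ℕ) :
    ‖epsSum c (F * p ^ N) (angleFun χ n) - epsSum c F (angleFun χ n)‖ ≤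
      q p * (q p : ℝ)⁻¹ ^ n * ‖(F : ℂ_[p])‖ * p :=
  norm_epsSum_mul_sub_le hc hF (pow_ne_zero N hp.out.ne_zero) hcF
    ((coprime_p hqF hcF).pow_right N) (by positivity)
    (norm_angleFun_add_mul_sub_le χ hqF hfF n)

/-- The integral of `χω⁻¹(a) (⟨a⟩ - 1) ^ n` against `ε`, the limit of its Riemann sums,
which converge by `tendsto_epsMoment`. -/
noncomputable def epsMoment (χ : DirichletCharacter ℂ_[p] f) (c F n : ℕ) : ℂ_[p] :=
  limUnder atTop fun N : ℕ => epsSum c (F * p ^ N) (angleFun χ n)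

theorem tendsto_epsMoment (χ : DirichletCharacter ℂ_[p] f) {c F : ℕ} (hc : 0 < c)
    (hF : F ≠ 0) (hqF : q p ∣ F) (hfF : f ∣ F) (hcF : c.Coprime F) (n : ℕ) :
    Tendsto (fun N : ℕ => epsSum c (F * p ^ N) (angleFun χ n)) atTop
      (𝓝 (epsMoment χ c F n)) := by
  refine CauchySeq.tendsto_limUnder (cauchySeq_of_le_tendsto_0'
    (fun N => q p * (q p : ℝ)⁻¹ ^ n * ‖((F * p ^ N : ℕ) : ℂ_[p])‖ * p) (fun N N' hNN' => ?_) ?_)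
  · rw [dist_comm, dist_eq_norm, ← Nat.add_sub_cancel' hNN', pow_add, ← mul_assoc]
    exact norm_epsSum_angleFun_sub_le χ hc (mul_p_pow_ne_zero hF N) (hqF.mul_right _)
      (hfF.mul_right _) (hcF.mul_right ((coprime_p hqF hcF).pow_right N)) n _
  · simpa using ((tendsto_mul_p_pow (p := p) F).norm.const_mul
      (q p * (q p : ℝ)⁻¹ ^ n)).mul_const (p : ℝ)

theorem norm_epsMoment_sub_le (χ : DirichletCharacter ℂ_[p] f) {c F : ℕ} (hc : 0 < c)
    (hF : F ≠ 0) (hqF : q p ∣ F) (hfF : f ∣ F) (hcF : c.Coprime F) (n : ℕ) :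
    ‖epsMoment χ c F n - epsSum c F (angleFun χ n)‖ ≤
      q p * (q p : ℝ)⁻¹ ^ n * ‖(F : ℂ_[p])‖ * p :=
  le_of_tendsto ((tendsto_epsMoment χ hc hF hqF hfF hcF n).sub_const _).norm
    (Eventually.of_forall (norm_epsSum_angleFun_sub_le χ hc hF hqF hfF hcF n))

theorem newtonBound_epsSum (χ : DirichletCharacter ℂ_[p] f) (c F : ℕ) :
    NewtonBound fun n => epsSum c F (angleFun χ n) :=
  newtonBound_of_norm_le p_pos.le fun n => by
    rw [mul_comm]
    exact norm_epsSum_le (by positivity) (norm_angleFun_le χ n)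

theorem newtonBound_epsMoment (χ : DirichletCharacter ℂ_[p] f) {c F : ℕ} (hc : 0 < c)
    (hF : F ≠ 0) (hqF : q p ∣ F) (hfF : f ∣ F) (hcF : c.Coprime F) :
    NewtonBound (epsMoment χ c F) :=
  newtonBound_of_norm_le p_pos.le fun n =>
    le_of_tendsto (tendsto_epsMoment χ hc hF hqF hfF hcF n).norm (Eventually.of_forall fun N => by
      rw [mul_comm (p : ℝ)]
      exact norm_epsSum_le (by positivity) (norm_angleFun_le χ n))

/-- The integral of `χω⁻¹(a) ⟨a⟩ ^ (-s)` against `ε`, expanded as a Newton series. -/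
noncomputable def epsIntegral (χ : DirichletCharacter ℂ_[p] f) (c F : ℕ) (s : ℂ_[p]) : ℂ_[p] :=
  ∑' n, binom p (-s) n * epsMoment χ c F n

theorem analyticOnDisc_epsIntegral (χ : DirichletCharacter ℂ_[p] f) {c F : ℕ} (hc : 0 < c)
    (hF : F ≠ 0) (hqF : q p ∣ F) (hfF : f ∣ F) (hcF : c.Coprime F) :
    AnalyticOnDisc (epsIntegral χ c F) := by
  have h := (newtonBound_epsMoment χ hc hF hqF hfF hcF).analyticOnDisc (β := 0) (by simp)
  simp only [zero_sub] at h
  exact h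

theorem dirichletSum_eq_tsum [NeZero f] {χ : DirichletCharacter ℂ_[p] f} (hprim : χ.IsPrimitive)
    (c F : ℕ) {s : ℂ_[p]} (hs : ‖s‖ < radius p) :
    dirichletSum χ c F s = ∑' n, binom p (-s) n * epsSum c F (angleFun χ n) := by
  have hs' : ‖-s‖ < radius p := by rwa [norm_neg]
  have hterm : ∀ a ∈ Icc 1 F, HasSum
      (fun n => binom p (-s) n * (angleFun χ n a * ((eps (a : ℤ) c F : ℚ) : ℂ_[p])))
      (if ¬ p ∣ a then
        twist χ 1 (a : ZMod _) * anglePow p a (-s) * ((eps (a : ℤ) c F : ℚ) : ℂ_[p]) else 0) := by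
    intro a _
    split_ifs with ha
    · simp only [angleFun, twistFun_of_dvd χ 1 ha, zero_mul, mul_zero]
      exact hasSum_zero
    · have h := (((newtonBound_angle ha).summable hs').hasSum.mul_left (twistFun χ 1 a)).mul_right
        ((eps (a : ℤ) c F : ℚ) : ℂ_[p])
      rw [twist_apply hprim 1 ha]
      refine h.congr_fun fun n => ?_
      rw [angleFun]
      ring
  rw [dirichletSum, sum_filter, ← (hasSum_sum hterm).tsum_eq]
  refine tsum_congr fun n => ?_
  rw [epsSum, mul_sum]

/-- The error of the Riemann sum modulo `F`. In the `n`-th term of the Newton series the growth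
`q ^ n` of the binomial coefficient cancels against the size of `(⟨a⟩ - 1) ^ n`; a factor `q`
remains, as one factor `⟨a⟩ - 1` is replaced by a difference divisible by `F`, and a factor `p`
bounds the denominator `2` of `ε`. -/
theorem norm_epsIntegral_sub_dirichletSum_le [NeZero f] {χ : DirichletCharacter ℂ_[p] f}
    (hprim : χ.IsPrimitive) {c F : ℕ} (hc : 0 < c) (hF : F ≠ 0) (hqF : q p ∣ F) (hfF : f ∣ F)
    (hcF : c.Coprime F) {s : ℂ_[p]} (hs : ‖s‖ < radius p) :
    ‖epsIntegral χ c F s - dirichletSum χ c F s‖ ≤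
      ‖(F : ℂ_[p]) / ((q p : ℂ_[p]) * (p : ℂ_[p]))‖ := by
  have hs' : ‖-s‖ < radius p := by rwa [norm_neg]
  have hq := q_pos p
  have hp0 := p_pos (p := p)
  rw [epsIntegral, dirichletSum_eq_tsum hprim c F hs,
    ← ((newtonBound_epsMoment χ hc hF hqF hfF hcF).summable hs').tsum_sub
      ((newtonBound_epsSum χ c F).summable hs')]
  refine IsUltrametricDist.norm_tsum_le_of_forall_le fun n => ?_
  rw [← mul_sub, norm_mul, norm_div, norm_mul, norm_q, norm_p]
  calc _ ≤ (q p : ℝ) ^ n * (q p * (q p : ℝ)⁻¹ ^ n * ‖(F : ℂ_[p])‖ * p) := by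
        gcongr
        · exact norm_binom_le_q_pow hs' n
        · exact norm_epsMoment_sub_le χ hc hF hqF hfF hcF n
    _ = _ := by
        rw [inv_pow]
        field_simp

/-- Integrals of `χω⁻ᵐ(a) a ^ (m - 1)` against `ε`. They come from comparing
`∑ χω⁻ᵐ(c t) (c t) ^ m` with `∑ χω⁻ᵐ(b) b ^ m`, where `c t = b + F k` and `k` is the digit in the
definition of `ε`: modulo `F ^ 2` the difference is `m F ∑ χω⁻ᵐ(b) b ^ (m - 1) k`. -/
theorem tendsto_epsSum_twistFun (χ : DirichletCharacter ℂ_[p] f) {c F : ℕ} (hc : 0 < c)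
    (hF : F ≠ 0) (hqF : q p ∣ F) (hfF : f ∣ F) (hcF : c.Coprime F) {m : ℕ} (hm : 1 ≤ m)
    {H : ℂ_[p]} (hH : Tendsto (fun N => ((F * p ^ N : ℕ) : ℂ_[p])⁻¹ *
      ∑ t ∈ Icc 1 (F * p ^ N), twistFun χ m t * (t : ℂ_[p]) ^ m) atTop (𝓝 H)) :
    Tendsto (fun N => epsSum c (F * p ^ N) fun a => twistFun χ m a * (a : ℂ_[p]) ^ (m - 1)) atTop
      (𝓝 ((1 - twistFun χ m c * (c : ℂ_[p]) ^ m) * H / m)) := by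
  have hm0 : (m : ℂ_[p]) ≠ 0 := by exact_mod_cast (by omega : m ≠ 0)
  have hF0 : ∀ N, ((F * p ^ N : ℕ) : ℂ_[p]) ≠ 0 := fun N =>
    Nat.cast_ne_zero.mpr (mul_p_pow_ne_zero hF N)
  have hFlim := tendsto_mul_p_pow (p := p) F
  have hlow := tendsto_mean_periodic_mul_pow (M := fun N => p ^ N)
    (fun N => pow_ne_zero N hp.out.ne_zero) (by simpa using tendsto_mul_p_pow (p := p) 1)
    (twistFun_add χ m hqF hfF) (m - 1)
  have hcarry : ∀ N, ∃ e : ℂ_[p], ‖e‖ ≤ 1 ∧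
      m * ∑ b ∈ Icc 1 (F * p ^ N),
        twistFun χ m b * (b : ℂ_[p]) ^ (m - 1) * carry c (F * p ^ N) b =
      (twistFun χ m c * (c : ℂ_[p]) ^ m - 1) * (((F * p ^ N : ℕ) : ℂ_[p])⁻¹ *
        ∑ t ∈ Icc 1 (F * p ^ N), twistFun χ m t * (t : ℂ_[p]) ^ m) -
        ((F * p ^ N : ℕ) : ℂ_[p]) * e := by
    intro N
    set G := F * p ^ N with hG
    have hcG : c.Coprime G := hcF.mul_right ((coprime_p hqF hcF).pow_right N)
    have hperm := sum_add_mul_carry hc hcG fun x => twistFun χ m x * (x : ℂ_[p]) ^ m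
    -- the integral remainder `w b` of the first order expansion of `(b + G k) ^ m`
    let w : ℕ → ℕ := fun b => (Polynomial.powAddExpansion b (G * carry c G b) m).1
    have hw : ∀ b, (b + G * carry c G b) ^ m = b ^ m + m * b ^ (m - 1) * (G * carry c G b) +
        w b * (G * carry c G b) ^ 2 := fun b =>
      (Polynomial.powAddExpansion b (G * carry c G b) m).2
    refine ⟨∑ b ∈ Icc 1 G, twistFun χ m b * ((w b * carry c G b ^ 2 : ℕ) : ℂ_[p]), ?_, ?_⟩
    · refine IsUltrametricDist.norm_sum_le_of_forall_le_of_nonneg zero_le_one fun b _ => ?_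
      rw [norm_mul]
      exact mul_le_one₀ (norm_twistFun_le χ m b) (norm_nonneg _) (norm_natCast_le_one _)
    have hl : ∑ b ∈ Icc 1 G, twistFun χ m (b + G * carry c G b) *
        ((b + G * carry c G b : ℕ) : ℂ_[p]) ^ m =
        ∑ b ∈ Icc 1 G, twistFun χ m b * (b : ℂ_[p]) ^ m +
        G * (m * ∑ b ∈ Icc 1 G, twistFun χ m b * (b : ℂ_[p]) ^ (m - 1) * carry c G b) +
        G ^ 2 * ∑ b ∈ Icc 1 G, twistFun χ m b * ((w b * carry c G b ^ 2 : ℕ) : ℂ_[p]) := by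
      rw [mul_sum, mul_sum, mul_sum, ← sum_add_distrib, ← sum_add_distrib]
      refine sum_congr rfl fun b _ => ?_
      rw [twistFun_add_mul χ m (hqF.mul_right _) (hfF.mul_right _), ← Nat.cast_pow, hw]
      push_cast
      ring
    have hr : ∑ t ∈ Icc 1 G, twistFun χ m (c * t) * ((c * t : ℕ) : ℂ_[p]) ^ m =
        twistFun χ m c * (c : ℂ_[p]) ^ m * ∑ t ∈ Icc 1 G, twistFun χ m t * (t : ℂ_[p]) ^ m := by
      rw [mul_sum]
      refine sum_congr rfl fun t _ => ?_
      rw [twistFun_mul]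
      push_cast
      ring
    rw [hl, hr] at hperm
    have hG0 : (G : ℂ_[p]) ≠ 0 := hF0 N
    refine mul_left_cancel₀ hG0 ?_
    rw [mul_sub, mul_left_comm (G : ℂ_[p]) (_ - 1), mul_inv_cancel_left₀ hG0]
    linear_combination hperm
  choose e he hcarry using hcarry
  have herr : Tendsto (fun N => ((F * p ^ N : ℕ) : ℂ_[p]) * e N) atTop (𝓝 0) := by
    refine squeeze_zero_norm (fun N => ?_) (norm_zero (E := ℂ_[p]) ▸ hFlim.norm)
    rw [norm_mul]
    exact mul_le_of_le_one_right (norm_nonneg _) (he N)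
  have hlim := ((hFlim.mul hlow).const_mul (((c : ℂ_[p]) - 1) / 2)).sub
    (((hH.const_mul (twistFun χ m c * (c : ℂ_[p]) ^ m - 1)).sub herr).div_const (m : ℂ_[p]))
  have hval : ((c : ℂ_[p]) - 1) / 2 * (0 * ((F : ℂ_[p])⁻¹ *
      ∑ a ∈ Icc 1 F, twistFun χ m a * bernoulliForm (m - 1) a F)) -
      ((twistFun χ m c * (c : ℂ_[p]) ^ m - 1) * H - 0) / m =
      (1 - twistFun χ m c * (c : ℂ_[p]) ^ m) * H / m := by
    ring
  rw [hval] at hlim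
  refine hlim.congr fun N => ?_
  rw [epsSum_eq, ← hcarry N, mul_inv_cancel_left₀ (hF0 N), mul_div_cancel_left₀ _ hm0]

/-- The interpolation property of the regularized function. -/
theorem epsIntegral_one_sub [NeZero f] {χ : DirichletCharacter ℂ_[p] f} (hprim : χ.IsPrimitive)
    {c F : ℕ} (hc : 0 < c) (hF : F ≠ 0) (hqF : q p ∣ F) (hfF : f ∣ F) (hcF : c.Coprime F)
    {m : ℕ} (hm : 1 ≤ m) : epsIntegral χ c F (1 - (m : ℂ_[p])) =
      (1 - χ (c : ZMod f) * anglePow p c (m : ℂ_[p])) *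
        ((1 - twist χ m (p : ZMod _) * (p : ℂ_[p]) ^ (m - 1)) * genBernoulli (twist χ m) m) /
          m := by
  have hpc := not_dvd_of_coprime hqF hcF
  have hχc : χ (c : ZMod f) * anglePow p c (m : ℂ_[p]) = twistFun χ m c * (c : ℂ_[p]) ^ m := by
    have h := twistFun_mul_angle_pow χ 0 m c
    rw [twistFun_of_not_dvd χ 0 hpc, pow_zero, mul_one, zero_add] at h
    rw [anglePow_natCast, h]
  have hs : -(1 - (m : ℂ_[p])) = ((m - 1 : ℕ) : ℂ_[p]) := by
    rw [Nat.cast_pred hm]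
    ring
  rw [hχc, epsIntegral, hs, newton_natCast]
  refine tendsto_nhds_unique (tendsto_finsetSum (range (m - 1 + 1)) fun n _ =>
    (tendsto_epsMoment χ hc hF hqF hfF hcF n).const_mul ((m - 1).choose n : ℂ_[p]))
    ((tendsto_epsSum_twistFun χ hc hF hqF hfF hcF hm
      (tendsto_mean_twistFun hprim hF hqF hfF hm)).congr fun N => ?_)
  have h : ∀ a : ℕ, twistFun χ m a * (a : ℂ_[p]) ^ (m - 1) =
      ∑ n ∈ range (m - 1 + 1), ((m - 1).choose n : ℂ_[p]) * angleFun χ n a := by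
    intro a
    have h1 := twistFun_mul_angle_pow χ 1 (m - 1) a
    rw [Nat.add_sub_cancel' hm] at h1
    rw [← h1, ← sum_choose_mul_sub_one_pow, mul_sum]
    exact sum_congr rfl fun n _ => by
      rw [angleFun]
      ring
  simp only [h, epsSum, sum_mul, mul_sum]
  rw [sum_comm]
  exact sum_congr rfl fun n _ => sum_congr rfl fun a _ => by ring

theorem analyticOnDisc_eulerFactor (χ : DirichletCharacter ℂ_[p] f) {c : ℕ} (hc : ¬ p ∣ c) :
    AnalyticOnDisc fun s => χ (c : ZMod f) * anglePow p c (1 - s) - 1 :=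
  ((analyticOnDisc_const _).mul ((newtonBound_angle hc).analyticOnDisc norm_one.le)).sub
    (analyticOnDisc_const 1)

/-- If `χ = 1`, the identity theorem is applied after multiplication by `s - 1`, as
`L_p(s, χ)` then has a pole at `s = 1`. -/
theorem regularizedL_eq_epsIntegral [NeZero f] {χ : DirichletCharacter ℂ_[p] f}
    (hprim : χ.IsPrimitive) {c F : ℕ} (hc : 0 < c) (hF : F ≠ 0) (hqF : q p ∣ F) (hfF : f ∣ F)
    (hcF : c.Coprime F) {s : ℂ_[p]} (hs : ‖s‖ < radius p) (hs1 : χ = 1 → s ≠ 1) :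
    regularizedL χ c s = epsIntegral χ c F s := by
  have hpc := not_dvd_of_coprime hqF hcF
  have hG := analyticOnDisc_epsIntegral χ hc hF hqF hfF hcF
  have hE := analyticOnDisc_eulerFactor χ hpc
  by_cases hχ : χ = 1
  · have hs1 := hs1 hχ
    have h := (hE.mul (analyticOnDisc_poleFun χ hqF)).eqOn
      ((analyticOnDisc_id.sub (analyticOnDisc_const 1)).mul hG) (fun k => by
        have hn : ((p ^ k + 1 : ℕ) : ℂ_[p]) ≠ 0 := Nat.cast_ne_zero.mpr (Nat.succ_ne_zero _)
        rw [neg_p_pow_eq, poleFun_one_sub hprim hF hqF hfF (Nat.le_add_left 1 _),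
          epsIntegral_one_sub hprim hc hF hqF hfF hcF (Nat.le_add_left 1 _), sub_sub_cancel]
        field_simp
        ring) hs
    refine mul_left_cancel₀ (sub_ne_zero.mpr hs1) ?_
    rw [← h, ← sub_one_mul_padicL hprim hχ hF hqF hfF hs hs1, regularizedL]
    ring
  · have h := (hE.mul (analyticOnDisc_padicL hprim hχ)).eqOn hG (fun k => by
        rw [neg_p_pow_eq, (isPadicLFunction_padicL hprim).interpolation _ (Nat.le_add_left 1 _),
          epsIntegral_one_sub hprim hc hF hqF hfF hcF (Nat.le_add_left 1 _), sub_sub_cancel]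
        ring) hs
    rw [← h, regularizedL]
    ring

theorem exists_eps_eq {c : ℕ} (hc : 0 < c) (F : ℕ) (a : ℤ) :
    ∃ j ∈ range c, eps a c F = -(((c : ℚ) - 1) / 2) + (j : ℚ) := by
  have : NeZero c := ⟨hc.ne'⟩
  have hlt := ZMod.val_lt (-(a : ZMod c) * (F : ZMod c)⁻¹)
  refine ⟨c - 1 - (-(a : ZMod c) * (F : ZMod c)⁻¹).val, mem_range.mpr (by omega), ?_⟩
  rw [eps, Nat.cast_sub (by omega), Nat.cast_pred hc]
  ring

end Regularized

end KubotaLeopoldt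

theorem mainTheorem1 (p : ℕ) [Fact p.Prime] (f : ℕ) [NeZero f]
    (χ : DirichletCharacter ℂ_[p] f) (hprim : χ.IsPrimitive) (heven : χ.Even)
    (F : ℕ) (hF : 0 < F) (hqF : KubotaLeopoldt.q p ∣ F) (hfF : f ∣ F)
    (c : ℕ) (hc : 1 < c) (hcF : c.Coprime F) :
    (∀ a : ℤ, ∃ j ∈ Finset.range c,
      KubotaLeopoldt.eps a c F = -(((c : ℚ) - 1) / 2) + (j : ℚ)) ∧
    (∀ s : ℂ_[p], ‖s‖ < KubotaLeopoldt.radius p → (χ = 1 → s ≠ 1) →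
      ‖KubotaLeopoldt.regularizedL χ c s - KubotaLeopoldt.dirichletSum χ c F s‖ ≤
        ‖(F : ℂ_[p]) / ((KubotaLeopoldt.q p : ℂ_[p]) * (p : ℂ_[p]))‖) ∧
    (χ = 1 → ∃ y : ℂ_[p],
      Filter.Tendsto (KubotaLeopoldt.regularizedL χ c) (𝓝[≠] (1 : ℂ_[p])) (𝓝 y) ∧
      ‖y - KubotaLeopoldt.dirichletSum χ c F 1‖ ≤
        ‖(F : ℂ_[p]) / ((KubotaLeopoldt.q p : ℂ_[p]) * (p : ℂ_[p]))‖) := by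
  have hc0 : 0 < c := by omega
  have h1 : ‖(1 : ℂ_[p])‖ < KubotaLeopoldt.radius p := by
    rw [norm_one]
    exact KubotaLeopoldt.one_lt_radius
  refine ⟨KubotaLeopoldt.exists_eps_eq hc0 F, fun s hs hs1 => ?_, fun hχ =>
    ⟨KubotaLeopoldt.epsIntegral χ c F 1, ?_,
      KubotaLeopoldt.norm_epsIntegral_sub_dirichletSum_le hprim hc0 hF.ne' hqF hfF hcF h1⟩⟩
  · rw [KubotaLeopoldt.regularizedL_eq_epsIntegral hprim hc0 hF.ne' hqF hfF hcF hs hs1]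
    exact KubotaLeopoldt.norm_epsIntegral_sub_dirichletSum_le hprim hc0 hF.ne' hqF hfF hcF hs
  · have hcont := (KubotaLeopoldt.analyticOnDisc_epsIntegral χ hc0 hF.ne' hqF hfF
      hcF).continuousAt_one
    refine (hcont.tendsto.mono_left nhdsWithin_le_nhds).congr' ?_
    have hball : ∀ᶠ s : ℂ_[p] in 𝓝 1, ‖s‖ < KubotaLeopoldt.radius p :=
      continuous_norm.continuousAt.eventually_lt continuousAt_const h1
    filter_upwards [nhdsWithin_le_nhds hball, self_mem_nhdsWithin] with s hs hs1
    exact (KubotaLeopoldt.regularizedL_eq_epsIntegral hprim hc0 hF.ne' hqF hfF hcF hs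
      fun _ => hs1).symm
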